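/- Let $\mathcal C$ be a category and $\mathcal D$ a class of maps of $\mathcal C$. Assume: * ($\mathcal D$ is *stable*) for every $d:E\to B$ in $\mathcal D$ and every map $f:X\to B$ of $\mathcal C$, a pullback of $d$ along $f$ exists, and every such pullback $X\times_B E\to X$ is in $\mathcal D$; * ($\mathcal D$ is *closed*) (1) $\mathcal C$ has a terminal object $1$, and every map $X\to 1$ is in $\mathcal D$; (2) $\mathcal D$ is closed under composition; (3) writing $\mathcal D(B)$ for the full subcategory of $\mathcal C/B$ on the $\mathcal D$-maps into $B$, for every $d:E\to B$ in $\mathcal D$ the pullback functor $d^*:\mathcal D(B)\to\mathcal D(E)$ has a right adjoint $d_*$, and $d_*$ is computed in the slices of $\mathcal C$: for all $q\in\mathcal D(E)$ the counit $d^*d_*q\to q$ induces a bijection $\mathcal C/B\,(z,d_*q)\cong\mathcal C/E\,(d^*z,q)$ for every object $z$ of $\mathcal C/B$, not only for those in $\mathcal D(B)$; * ($\mathcal D$ is *factorizing*) every map $f$ of $\mathcal C$ factors as $f=d\circ a$ with $d\in\mathcal D$ and $a$ *anodyne*, i.e. with the left lifting property against all maps in $\mathcal D$. Then there is a category with families (presheaves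 of types and of terms on $\mathcal C$ with a typing map, an empty context, and context extensions $\Gamma.A$ with display maps $p_A:\Gamma.A\to\Gamma$) whose category of contexts and substitutions is $\mathcal C$, such that: * it has dependent sums $\Sigma$ (formation, pairing, two projections, with $\pi_1\langle a,b\rangle=a$, $\pi_2\langle a,b\rangle=b$, $\langle\pi_1c,\pi_2c\rangle=c$), dependent products $\Pi$ (formation, abstraction, application, with the $\beta$- and $\eta$-equations), and intensional identity types $\mathsf{Id}$ (formation, reflexivity, and an eliminator $\mathsf j$ which, for $A$ in context $\Gamma$, $T$ in context $\Gamma.A.A.\mathsf{Id}_A$ and $t:T[\rho_A]$ in context $\Gamma.A$, where $\rho_A=(x\mapsto(x,x,\mathsf{refl}\,x))$, gives $\mathsf j(t):T$ with $\mathsf j(t)[\rho_A]=t$), and all of these operations commute strictly with substitution; * every display map $p_A$ is in $\mathcal D$, and for each $X\in\mathcal C$ the functor $A\mapsto (p_A:X.A\to X)$ is an equivalence from the category of types in context $X$ (whose morphisms $A\to B$ are the terms of type $B[p_A]$ in context $X.A$) to $\mathcal D(X)$; * for each type $A$ in context $X$, $a\mapsto(1_X,a)$ is a bijection from the terms of type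 $A$ in context $X$ to the sections of $p_A:X.A\to X$. -/

import Mathlib

open CategoryTheory Opposite

universe w v u

/-! ### Categories with families -/

/-- A presheaf of types and a presheaf of terms over a category of contexts, with the typing map. -/
structure TypesAndTerms (C : Type u) [Category.{v} C] where
  Ty : Cᵒᵖ ⥤ Type w
  Tm : Cᵒᵖ ⥤ Type w
  typing : Tm ⟶ Ty

namespace TypesAndTerms

variable {C : Type u} [Category.{v} C] (M : TypesAndTerms.{w} C) {Γ Δ Θ : C}

/-- The types in context `Γ`. -/
abbrev Types (Γ : C) : Type w := M.Ty.obj (op Γ)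

/-- The terms in context `Γ`, of arbitrary type. -/
abbrev Terms (Γ : C) : Type w := M.Tm.obj (op Γ)

variable {M}

/-- The type of a term. -/
def tp (a : M.Terms Γ) : M.Types Γ := M.typing.app (op Γ) a

/-- Substitution in types, `A[σ]`. -/
def tySub (A : M.Types Γ) (σ : Δ ⟶ Γ) : M.Types Δ := M.Ty.map σ.op A

/-- Substitution in terms, `a[σ]`. -/
def tmSub (a : M.Terms Γ) (σ : Δ ⟶ Γ) : M.Terms Δ := M.Tm.map σ.op a

theorem tySub_id (A : M.Types Γ) : tySub A (𝟙 Γ) = A := by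
  simp [tySub]

theorem tmSub_id (a : M.Terms Γ) : tmSub a (𝟙 Γ) = a := by
  simp [tmSub]

theorem tySub_comp (A : M.Types Γ) (τ : Θ ⟶ Δ) (σ : Δ ⟶ Γ) :
    tySub A (τ ≫ σ) = tySub (tySub A σ) τ := by
  simp [tySub]

theorem tmSub_comp (a : M.Terms Γ) (τ : Θ ⟶ Δ) (σ : Δ ⟶ Γ) :
    tmSub a (τ ≫ σ) = tmSub (tmSub a σ) τ := by
  simp [tmSub]

theorem tp_tmSub (a : M.Terms Γ) (σ : Δ ⟶ Γ) : tp (tmSub a σ) = tySub (tp a) σ :=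
  NatTrans.naturality_apply M.typing σ.op a

end TypesAndTerms

open TypesAndTerms

/-- A category with families whose category of contexts and substitutions is `C`: types and terms
with substitution, a terminal (empty) context, and context extension `Γ.A` with its projection
`wk A : Γ.A ⟶ Γ`, its variable `var A : A[wk A]`, and the pairing `(σ, a) : Δ ⟶ Γ.A`. -/
structure CwF (C : Type u) [Category.{v} C] extends TypesAndTerms.{w} C where
  empty : C
  emptyIsTerminal : Limits.IsTerminal empty
  ext : ∀ {Γ : C}, toTypesAndTerms.Types Γ → C
  wk : ∀ {Γ : C} (A : toTypesAndTerms.Types Γ), ext A ⟶ Γ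
  var : ∀ {Γ : C} (A : toTypesAndTerms.Types Γ), toTypesAndTerms.Terms (ext A)
  tp_var : ∀ {Γ : C} (A : toTypesAndTerms.Types Γ), tp (var A) = tySub A (wk A)
  pair : ∀ {Γ Δ : C} (A : toTypesAndTerms.Types Γ) (σ : Δ ⟶ Γ) (a : toTypesAndTerms.Terms Δ),
    tp a = tySub A σ → (Δ ⟶ ext A)
  pair_wk : ∀ {Γ Δ : C} (A : toTypesAndTerms.Types Γ) (σ : Δ ⟶ Γ) (a : toTypesAndTerms.Terms Δ)
    (h : tp a = tySub A σ), pair A σ a h ≫ wk A = σ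
  var_pair : ∀ {Γ Δ : C} (A : toTypesAndTerms.Types Γ) (σ : Δ ⟶ Γ) (a : toTypesAndTerms.Terms Δ)
    (h : tp a = tySub A σ), tmSub (var A) (pair A σ a h) = a
  pair_eta : ∀ {Γ Δ : C} (A : toTypesAndTerms.Types Γ) (τ : Δ ⟶ ext A),
    pair A (τ ≫ wk A) (tmSub (var A) τ) (by rw [tp_tmSub, tp_var, tySub_comp]) = τ

namespace CwF

variable {C : Type u} [Category.{v} C] (M : CwF.{w} C) {Γ Δ Θ : C}

theorem hom_ext {A : M.Types Γ} {τ τ' : Δ ⟶ M.ext A} (h₁ : τ ≫ M.wk A = τ' ≫ M.wk A)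
    (h₂ : tmSub (M.var A) τ = tmSub (M.var A) τ') : τ = τ' := by
  rw [← M.pair_eta A τ, ← M.pair_eta A τ']
  congr 1

/-- The substitution `(1, a) : Γ ⟶ Γ.A` given by a term `a : A` in context `Γ`. -/
def inst (A : M.Types Γ) (a : M.Terms Γ) (ha : tp a = A) : Γ ⟶ M.ext A :=
  M.pair A (𝟙 Γ) a (by rw [ha, tySub_id])

/-- The substitution `σ.A : Δ.A' ⟶ Γ.A` over `σ : Δ ⟶ Γ`, where `A' = A[σ]`. -/
def lift (σ : Δ ⟶ Γ) (A : M.Types Γ) (A' : M.Types Δ) (h : A' = tySub A σ) :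
    M.ext A' ⟶ M.ext A :=
  M.pair A (M.wk A' ≫ σ) (M.var A') (by rw [M.tp_var, h, tySub_comp])

theorem inst_wk (A : M.Types Γ) (a : M.Terms Γ) (ha : tp a = A) :
    M.inst A a ha ≫ M.wk A = 𝟙 Γ := M.pair_wk _ _ _ _

theorem var_inst (A : M.Types Γ) (a : M.Terms Γ) (ha : tp a = A) :
    tmSub (M.var A) (M.inst A a ha) = a := M.var_pair _ _ _ _

theorem lift_wk (σ : Δ ⟶ Γ) (A : M.Types Γ) (A' : M.Types Δ) (h : A' = tySub A σ) :
    M.lift σ A A' h ≫ M.wk A = M.wk A' ≫ σ := M.pair_wk _ _ _ _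

theorem var_lift (σ : Δ ⟶ Γ) (A : M.Types Γ) (A' : M.Types Δ) (h : A' = tySub A σ) :
    tmSub (M.var A) (M.lift σ A A' h) = M.var A' := M.var_pair _ _ _ _

theorem inst_lift (σ : Δ ⟶ Γ) (A : M.Types Γ) (a : M.Terms Γ) (ha : tp a = A)
    (ha' : tp (tmSub a σ) = tySub A σ) :
    M.inst (tySub A σ) (tmSub a σ) ha' ≫ M.lift σ A _ rfl = σ ≫ M.inst A a ha := by
  apply M.hom_ext
  · simp only [Category.assoc, lift_wk, inst_wk, Category.comp_id]
    rw [← Category.assoc, inst_wk, Category.id_comp]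
  · rw [tmSub_comp, var_lift, var_inst, tmSub_comp, var_inst]

theorem tySub_inst_sub (σ : Δ ⟶ Γ) (A : M.Types Γ) (B : M.Types (M.ext A)) (a : M.Terms Γ)
    (ha : tp a = A) (ha' : tp (tmSub a σ) = tySub A σ) :
    tySub (tySub B (M.inst A a ha)) σ =
      tySub (tySub B (M.lift σ A _ rfl)) (M.inst (tySub A σ) (tmSub a σ) ha') := by
  rw [← tySub_comp, ← tySub_comp, inst_lift M σ A a ha]

theorem tp_sub_eq {a : M.Terms Γ} {A : M.Types Γ} (ha : tp a = A) (σ : Δ ⟶ Γ) :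
    tp (tmSub a σ) = tySub A σ := by rw [tp_tmSub, ha]

/-! ### Dependent sums, dependent products and intensional identity types

All operations commute with substitution. -/

/-- Strong dependent sums, with both projections and surjective pairing. -/
structure SigmaTypes where
  Sig : ∀ {Γ : C} (A : M.Types Γ), M.Types (M.ext A) → M.Types Γ
  Sig_sub : ∀ {Γ Δ : C} (σ : Δ ⟶ Γ) (A : M.Types Γ) (B : M.Types (M.ext A)),
    tySub (Sig A B) σ = Sig (tySub A σ) (tySub B (M.lift σ A _ rfl))
  pr : ∀ {Γ : C} (A : M.Types Γ) (B : M.Types (M.ext A)) (a b : M.Terms Γ) (ha : tp a = A),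
    tp b = tySub B (M.inst A a ha) → M.Terms Γ
  tp_pr : ∀ {Γ : C} (A : M.Types Γ) (B : M.Types (M.ext A)) (a b : M.Terms Γ) (ha : tp a = A)
    (hb : tp b = tySub B (M.inst A a ha)), tp (pr A B a b ha hb) = Sig A B
  fst : ∀ {Γ : C} (A : M.Types Γ) (B : M.Types (M.ext A)) (c : M.Terms Γ),
    tp c = Sig A B → M.Terms Γ
  tp_fst : ∀ {Γ : C} (A : M.Types Γ) (B : M.Types (M.ext A)) (c : M.Terms Γ)
    (hc : tp c = Sig A B), tp (fst A B c hc) = A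
  snd : ∀ {Γ : C} (A : M.Types Γ) (B : M.Types (M.ext A)) (c : M.Terms Γ),
    tp c = Sig A B → M.Terms Γ
  tp_snd : ∀ {Γ : C} (A : M.Types Γ) (B : M.Types (M.ext A)) (c : M.Terms Γ)
    (hc : tp c = Sig A B),
    tp (snd A B c hc) = tySub B (M.inst A (fst A B c hc) (tp_fst A B c hc))
  fst_pr : ∀ {Γ : C} (A : M.Types Γ) (B : M.Types (M.ext A)) (a b : M.Terms Γ) (ha : tp a = A)
    (hb : tp b = tySub B (M.inst A a ha)),
    fst A B (pr A B a b ha hb) (tp_pr A B a b ha hb) = a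
  snd_pr : ∀ {Γ : C} (A : M.Types Γ) (B : M.Types (M.ext A)) (a b : M.Terms Γ) (ha : tp a = A)
    (hb : tp b = tySub B (M.inst A a ha)),
    snd A B (pr A B a b ha hb) (tp_pr A B a b ha hb) = b
  pr_eta : ∀ {Γ : C} (A : M.Types Γ) (B : M.Types (M.ext A)) (c : M.Terms Γ)
    (hc : tp c = Sig A B),
    pr A B (fst A B c hc) (snd A B c hc) (tp_fst A B c hc) (tp_snd A B c hc) = c
  pr_sub : ∀ {Γ Δ : C} (σ : Δ ⟶ Γ) (A : M.Types Γ) (B : M.Types (M.ext A)) (a b : M.Terms Γ)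
    (ha : tp a = A) (hb : tp b = tySub B (M.inst A a ha)),
    tmSub (pr A B a b ha hb) σ =
      pr (tySub A σ) (tySub B (M.lift σ A _ rfl)) (tmSub a σ) (tmSub b σ) (M.tp_sub_eq ha σ)
        ((M.tp_sub_eq hb σ).trans (M.tySub_inst_sub σ A B a ha _))
  fst_sub : ∀ {Γ Δ : C} (σ : Δ ⟶ Γ) (A : M.Types Γ) (B : M.Types (M.ext A)) (c : M.Terms Γ)
    (hc : tp c = Sig A B),
    tmSub (fst A B c hc) σ = fst (tySub A σ) (tySub B (M.lift σ A _ rfl)) (tmSub c σ)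
      ((M.tp_sub_eq hc σ).trans (Sig_sub σ A B))
  snd_sub : ∀ {Γ Δ : C} (σ : Δ ⟶ Γ) (A : M.Types Γ) (B : M.Types (M.ext A)) (c : M.Terms Γ)
    (hc : tp c = Sig A B),
    tmSub (snd A B c hc) σ = snd (tySub A σ) (tySub B (M.lift σ A _ rfl)) (tmSub c σ)
      ((M.tp_sub_eq hc σ).trans (Sig_sub σ A B))

theorem tySub_lift_inst_var (A : M.Types Γ) (B : M.Types (M.ext A)) :
    tySub (tySub B (M.lift (M.wk A) A _ rfl)) (M.inst (tySub A (M.wk A)) (M.var A) (M.tp_var A))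
      = B := by
  rw [← tySub_comp]
  conv_rhs => rw [← tySub_id B]
  congr 1
  apply M.hom_ext
  · rw [Category.assoc, lift_wk, ← Category.assoc, inst_wk]
  · rw [tmSub_comp, var_lift, var_inst, tmSub_id]

/-- Dependent products, with the `β`-rule `(λ b)(a) = b[a]` and the `η`-rule `λ (f(x)) = f`. -/
structure PiTypes where
  Pi : ∀ {Γ : C} (A : M.Types Γ), M.Types (M.ext A) → M.Types Γ
  Pi_sub : ∀ {Γ Δ : C} (σ : Δ ⟶ Γ) (A : M.Types Γ) (B : M.Types (M.ext A)),
    tySub (Pi A B) σ = Pi (tySub A σ) (tySub B (M.lift σ A _ rfl))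
  lam : ∀ {Γ : C} (A : M.Types Γ), M.Terms (M.ext A) → M.Terms Γ
  tp_lam : ∀ {Γ : C} (A : M.Types Γ) (b : M.Terms (M.ext A)), tp (lam A b) = Pi A (tp b)
  app : ∀ {Γ : C} (A : M.Types Γ) (B : M.Types (M.ext A)) (f a : M.Terms Γ),
    tp f = Pi A B → tp a = A → M.Terms Γ
  tp_app : ∀ {Γ : C} (A : M.Types Γ) (B : M.Types (M.ext A)) (f a : M.Terms Γ)
    (hf : tp f = Pi A B) (ha : tp a = A), tp (app A B f a hf ha) = tySub B (M.inst A a ha)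
  beta : ∀ {Γ : C} (A : M.Types Γ) (b : M.Terms (M.ext A)) (a : M.Terms Γ) (ha : tp a = A),
    app A (tp b) (lam A b) a (tp_lam A b) ha = tmSub b (M.inst A a ha)
  eta : ∀ {Γ : C} (A : M.Types Γ) (B : M.Types (M.ext A)) (f : M.Terms Γ) (hf : tp f = Pi A B),
    lam A (app (tySub A (M.wk A)) (tySub B (M.lift (M.wk A) A _ rfl)) (tmSub f (M.wk A)) (M.var A)
      ((M.tp_sub_eq hf _).trans (Pi_sub (M.wk A) A B)) (M.tp_var A)) = f
  lam_sub : ∀ {Γ Δ : C} (σ : Δ ⟶ Γ) (A : M.Types Γ) (b : M.Terms (M.ext A)),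
    tmSub (lam A b) σ = lam (tySub A σ) (tmSub b (M.lift σ A _ rfl))
  app_sub : ∀ {Γ Δ : C} (σ : Δ ⟶ Γ) (A : M.Types Γ) (B : M.Types (M.ext A)) (f a : M.Terms Γ)
    (hf : tp f = Pi A B) (ha : tp a = A),
    tmSub (app A B f a hf ha) σ =
      app (tySub A σ) (tySub B (M.lift σ A _ rfl)) (tmSub f σ) (tmSub a σ)
        ((M.tp_sub_eq hf σ).trans (Pi_sub σ A B)) (M.tp_sub_eq ha σ)

/-- Formation and introduction for identity types: `Id a b` for two terms of the same type, and the
reflexivity term `refl a : Id a a`. -/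
structure IdIntro where
  Id : ∀ {Γ : C} (a b : M.Terms Γ), tp a = tp b → M.Types Γ
  Id_sub : ∀ {Γ Δ : C} (σ : Δ ⟶ Γ) (a b : M.Terms Γ) (h : tp a = tp b),
    tySub (Id a b h) σ =
      Id (tmSub a σ) (tmSub b σ) ((M.tp_sub_eq h σ).trans (tp_tmSub b σ).symm)
  refl : ∀ {Γ : C}, M.Terms Γ → M.Terms Γ
  tp_refl : ∀ {Γ : C} (a : M.Terms Γ), tp (refl a) = Id a a rfl
  refl_sub : ∀ {Γ Δ : C} (σ : Δ ⟶ Γ) (a : M.Terms Γ), tmSub (refl a) σ = refl (tmSub a σ)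

namespace IdIntro

variable {M} (I : M.IdIntro)

theorem Id_congr {a a' b b' : M.Terms Γ} (ha : a = a') (hb : b = b') (h : tp a = tp b)
    (h' : tp a' = tp b') : I.Id a b h = I.Id a' b' h' := by
  subst ha; subst hb; rfl

/-- The type `Id_A` in context `Γ.A.A`, between the two variables of type `A`. -/
def gen (A : M.Types Γ) : M.Types (M.ext (tySub A (M.wk A))) :=
  I.Id (tmSub (M.var A) (M.wk _)) (M.var (tySub A (M.wk A)))
    (by rw [tp_tmSub, M.tp_var, M.tp_var])

/-- The context `Γ.A.A.Id_A`. -/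
abbrev ctx (A : M.Types Γ) : C := M.ext (I.gen A)

theorem gen_inst (A : M.Types Γ) :
    tySub (I.gen A) (M.inst (tySub A (M.wk A)) (M.var A) (M.tp_var A)) =
      I.Id (M.var A) (M.var A) rfl := by
  unfold gen
  rw [I.Id_sub]
  apply I.Id_congr
  · rw [← tmSub_comp, M.inst_wk, tmSub_id]
  · rw [M.var_inst]

/-- The substitution `ρ_A : Γ.A ⟶ Γ.A.A.Id_A`, `x ↦ (x, x, refl x)`. -/
def rho (A : M.Types Γ) : M.ext A ⟶ I.ctx A :=
  M.pair (I.gen A) (M.inst (tySub A (M.wk A)) (M.var A) (M.tp_var A)) (I.refl (M.var A))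
    (by rw [I.gen_inst, I.tp_refl])

/-- The substitution `Δ.A[σ].A[σ] ⟶ Γ.A.A` over `σ : Δ ⟶ Γ`. -/
def lift₂ (σ : Δ ⟶ Γ) (A : M.Types Γ) :
    M.ext (tySub (tySub A σ) (M.wk (tySub A σ))) ⟶ M.ext (tySub A (M.wk A)) :=
  M.lift (M.lift σ A _ rfl) (tySub A (M.wk A)) _
    (by rw [← tySub_comp, ← tySub_comp, M.lift_wk])

theorem gen_sub (σ : Δ ⟶ Γ) (A : M.Types Γ) :
    I.gen (tySub A σ) = tySub (I.gen A) (lift₂ σ A) := by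
  unfold gen
  rw [I.Id_sub]
  apply I.Id_congr
  · rw [← tmSub_comp, lift₂, M.lift_wk, tmSub_comp, M.var_lift]
  · rw [lift₂, M.var_lift]

/-- The substitution `Δ.A[σ].A[σ].Id_{A[σ]} ⟶ Γ.A.A.Id_A` over `σ : Δ ⟶ Γ`. -/
def lift₃ (σ : Δ ⟶ Γ) (A : M.Types Γ) : I.ctx (tySub A σ) ⟶ I.ctx A :=
  M.lift (lift₂ σ A) (I.gen A) _ (I.gen_sub σ A)

theorem rho_lift₃ (σ : Δ ⟶ Γ) (A : M.Types Γ) :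
    I.rho (tySub A σ) ≫ I.lift₃ σ A = M.lift σ A _ rfl ≫ I.rho A := by
  apply M.hom_ext
  · rw [Category.assoc, lift₃, M.lift_wk, rho, rho, Category.assoc, M.pair_wk, ← Category.assoc,
      M.pair_wk, lift₂]
    apply M.hom_ext
    · rw [Category.assoc, M.lift_wk, Category.assoc, M.inst_wk, ← Category.assoc, M.inst_wk,
        Category.id_comp, Category.comp_id]
    · rw [tmSub_comp, M.var_lift, M.var_inst, tmSub_comp, M.var_inst, M.var_lift]
  · rw [tmSub_comp, lift₃, M.var_lift, rho, rho, M.var_pair, tmSub_comp, M.var_pair, I.refl_sub,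
      M.var_lift]

end IdIntro

/-- Intensional identity types: for `A` in context `Γ`, a type `T` in context `Γ.A.A.Id_A` and a
term `t : T[ρ_A]` in context `Γ.A`, a term `j t : T` with `(j t)[ρ_A] = t`. -/
structure IdTypes extends M.IdIntro where
  j : ∀ {Γ : C} (A : M.Types Γ) (T : M.Types (toIdIntro.ctx A)) (t : M.Terms (M.ext A)),
    tp t = tySub T (toIdIntro.rho A) → M.Terms (toIdIntro.ctx A)
  tp_j : ∀ {Γ : C} (A : M.Types Γ) (T : M.Types (toIdIntro.ctx A)) (t : M.Terms (M.ext A))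
    (ht : tp t = tySub T (toIdIntro.rho A)), tp (j A T t ht) = T
  j_rho : ∀ {Γ : C} (A : M.Types Γ) (T : M.Types (toIdIntro.ctx A)) (t : M.Terms (M.ext A))
    (ht : tp t = tySub T (toIdIntro.rho A)), tmSub (j A T t ht) (toIdIntro.rho A) = t
  j_sub : ∀ {Γ Δ : C} (σ : Δ ⟶ Γ) (A : M.Types Γ) (T : M.Types (toIdIntro.ctx A))
    (t : M.Terms (M.ext A)) (ht : tp t = tySub T (toIdIntro.rho A)),
    tmSub (j A T t ht) (toIdIntro.lift₃ σ A) =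
      j (tySub A σ) (tySub T (toIdIntro.lift₃ σ A)) (tmSub t (M.lift σ A _ rfl))
        (by rw [tp_tmSub, ht, ← tySub_comp, ← tySub_comp, toIdIntro.rho_lift₃])

/-! ### The category of types in a context -/

/-- The terms of type `A` in context `Γ`. -/
def TermsOf (A : M.Types Γ) : Type w := {a : M.Terms Γ // tp a = A}

/-- The category of types in context `Γ`: a morphism `A ⟶ B` is a term of type `B` in context
`Γ.A`. -/
structure TypesIn (Γ : C) where
  type : M.Types Γ

/-- The substitution `Γ.A ⟶ Γ.B` over `Γ` given by a term of type `B` in context `Γ.A`. -/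
def termMap (A B : M.Types Γ) (f : M.TermsOf (tySub B (M.wk A))) : M.ext A ⟶ M.ext B :=
  M.pair B (M.wk A) f.1 f.2

theorem termMap_wk (A B : M.Types Γ) (f : M.TermsOf (tySub B (M.wk A))) :
    M.termMap A B f ≫ M.wk B = M.wk A := M.pair_wk _ _ _ _

theorem var_termMap (A B : M.Types Γ) (f : M.TermsOf (tySub B (M.wk A))) :
    tmSub (M.var B) (M.termMap A B f) = f.1 := M.var_pair _ _ _ _

instance (Γ : C) : CategoryStruct (M.TypesIn Γ) where
  Hom A B := M.TermsOf (tySub B.type (M.wk A.type))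
  id A := ⟨M.var A.type, M.tp_var A.type⟩
  comp {A B _} f g := ⟨tmSub g.1 (M.termMap A.type B.type f), by
    rw [tp_tmSub, g.2, ← tySub_comp, termMap_wk]⟩

theorem termMap_id (A : M.TypesIn Γ) : M.termMap A.type A.type (𝟙 A : A ⟶ A) = 𝟙 _ := by
  apply M.hom_ext
  · rw [termMap_wk, Category.id_comp]
  · rw [var_termMap, tmSub_id]; rfl

theorem termMap_comp {A B D : M.TypesIn Γ} (f : A ⟶ B) (g : B ⟶ D) :
    M.termMap A.type D.type (f ≫ g) =
      M.termMap A.type B.type f ≫ M.termMap B.type D.type g := by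
  apply M.hom_ext
  · rw [Category.assoc, termMap_wk, termMap_wk, termMap_wk]
  · rw [var_termMap, tmSub_comp, var_termMap]; rfl

instance (Γ : C) : Category (M.TypesIn Γ) where
  id_comp {A B} f := by
    apply Subtype.ext
    change tmSub f.1 (M.termMap A.type A.type (𝟙 A : A ⟶ A)) = f.1
    rw [termMap_id, tmSub_id]
  comp_id {A B} f := M.var_termMap A.type B.type f |> Subtype.ext
  assoc {A B D E} f g h := by
    apply Subtype.ext
    change tmSub h.1 (M.termMap A.type D.type (f ≫ g)) =
      tmSub (tmSub h.1 (M.termMap B.type D.type g)) (M.termMap A.type B.type f)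
    rw [termMap_comp, tmSub_comp]

/-- The functor sending a type `A` in context `Γ` to its display map `Γ.A ⟶ Γ`, when all display
maps lie in `D`; its target `D.Over ⊤ Γ` is the full subcategory of `C / Γ` on the `D`-maps. -/
def display (D : MorphismProperty C) (hD : ∀ (Γ : C) (A : M.Types Γ), D (M.wk A)) (Γ : C) :
    M.TypesIn Γ ⥤ D.Over ⊤ Γ where
  obj A := MorphismProperty.Over.mk ⊤ (M.wk A.type) (hD Γ A.type)
  map {A B} f := MorphismProperty.Over.homMk (M.termMap A.type B.type f)
    (M.termMap_wk A.type B.type f)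
  map_id A := by
    apply MorphismProperty.Over.Hom.ext
    exact M.termMap_id A
  map_comp f g := by
    apply MorphismProperty.Over.Hom.ext
    exact M.termMap_comp f g

/-- The section `(1, a)` of the display map `Γ.A ⟶ Γ` given by a term `a : A`. -/
def toSection (A : M.Types Γ) (a : M.TermsOf A) : {s : Γ ⟶ M.ext A // s ≫ M.wk A = 𝟙 Γ} :=
  ⟨M.inst A a.1 a.2, M.inst_wk A a.1 a.2⟩

end CwF

/-! ### Closed classes of maps -/

/-- `r : P ⟶ B` together with `ev : P ×_B E ⟶ F` over `E` is the dependent product of `q : F ⟶ E`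
along `d : E ⟶ B`, in the slices of `C`: for every `z : T ⟶ B`, morphisms `h : z ⟶ r` over `B`
correspond bijectively to morphisms `g : T ×_B E ⟶ F` over `E`, via `g = (h ×_B E) ≫ ev`. Here
`P ×_B E` and `T ×_B E` are given by arbitrary pullback squares. -/
structure IsDependentProduct {C : Type u} [Category.{v} C] {B E F P PE : C} (d : E ⟶ B)
    (q : F ⟶ E) (r : P ⟶ B) (p₁ : PE ⟶ P) (p₂ : PE ⟶ E) (ev : PE ⟶ F) : Prop where
  isPullback : IsPullback p₁ p₂ r d
  ev_comp : ev ≫ q = p₂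
  existsUnique : ∀ {T TE : C} (z : T ⟶ B) (t₁ : TE ⟶ T) (t₂ : TE ⟶ E), IsPullback t₁ t₂ z d →
    ∀ g : TE ⟶ F, g ≫ q = t₂ →
      ∃! h : T ⟶ P, h ≫ r = z ∧ ∃ k : TE ⟶ PE, k ≫ p₁ = t₁ ≫ h ∧ k ≫ p₂ = t₂ ∧ k ≫ ev = g

/-- A stable class of maps `D` (every pullback of a `D`-map along an arbitrary map exists and lies
in `D`) is closed if `C` has a terminal object, every map to a terminal object is in `D`, `D` is
closed under composition, and pullback `d^* : D(B) ⥤ D(E)` along any `D`-map `d : E ⟶ B` has a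
right adjoint `d_* : D(E) ⥤ D(B)` which is computed in the slices of `C`: the counit
`d^* (d_* q) ⟶ q` is universal among all objects of `C / B`, not only those of `D(B)`. -/
structure IsClosedClass {C : Type u} [Category.{v} C] (D : MorphismProperty C) [D.HasPullbacks]
    [D.IsStableUnderBaseChange] : Prop where
  hasTerminal : Limits.HasTerminal C
  toTerminal : ∀ {X Y : C} (f : X ⟶ Y), Nonempty (Limits.IsTerminal Y) → D f
  comp : D.IsStableUnderComposition
  pushforward : ∀ {E B : C} (d : E ⟶ B), D d →
    ∃ (R : D.Over ⊤ E ⥤ D.Over ⊤ B) (adj : MorphismProperty.Over.pullback D ⊤ d ⊣ R),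
      ∀ q : D.Over ⊤ E,
        IsDependentProduct d q.hom (R.obj q).hom (Limits.pullback.fst (R.obj q).hom d)
          (Limits.pullback.snd (R.obj q).hom d) (adj.counit.app q).left

-- Pullback is functorial only up to isomorphism, so types cannot simply be `D`-maps. Instead, a
-- type in context Γ is a `D`-map E ⟶ B (a local universe) together with a name Γ ⟶ B. Substitution
-- is composition of names, hence strict, and pullbacks are chosen only to form context extensions.
-- A `D`-map over Γ, viewed as a local universe with name 𝟙 Γ, is isomorphic to a display map; this
-- gives the equivalence of types with `D`-maps.
--
-- Types therefore form a coproduct of representables. The same holds for the inputs of the other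
-- operations: pairs (A, B), and elimination problems (A, T, t). Each operation is constructed once,
-- on the generic inputs, and transported along the unique classifying map; strict stability under
-- substitution then follows from uniqueness. The generic inputs exist because `D`-maps are
-- exponentiable in the slices of `C`: `exists_partialProduct` represents the maps T ×_B E ⟶ X. It
-- uses that X ⟶ 1 is in `D` and that pushforwards are universal among all z : T ⟶ B, a context over
-- B being arbitrary.
--
-- On generic inputs no coherence is left to arrange. Sums are composites of display maps, products
-- are pushforwards, identity types factor the diagonal as an anodyne map followed by a `D`-map, and
-- the eliminator is a diagonal filler. The filler needs ρ to be anodyne over the context of the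
-- generic elimination problem. That context lies over the base of a generic type by a `D`-map, and
-- anodyne maps are stable under pullback along `D`-maps (`llp_of_isPullback`).

universe x

/-! ### Substitution calculus, context extension as pullback, and display maps -/

namespace CwF

variable {C : Type u} [Category.{v} C] (M : CwF.{w} C) {Γ Δ Θ : C}

theorem pair_congr (A : M.Types Γ) {σ σ' : Δ ⟶ Γ} {a a' : M.Terms Δ} (hσ : σ = σ') (ha : a = a')
    (h : tp a = tySub A σ) (h' : tp a' = tySub A σ') : M.pair A σ a h = M.pair A σ' a' h' := by
  subst hσ ha; rfl

theorem comp_pair (τ : Θ ⟶ Δ) (A : M.Types Γ) (σ : Δ ⟶ Γ) (a : M.Terms Δ)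
    (h : tp a = tySub A σ) (h' : tp (tmSub a τ) = tySub A (τ ≫ σ)) :
    τ ≫ M.pair A σ a h = M.pair A (τ ≫ σ) (tmSub a τ) h' := by
  apply M.hom_ext
  · rw [Category.assoc, M.pair_wk, M.pair_wk]
  · rw [tmSub_comp, M.var_pair, M.var_pair]

/-- The types `A'` and `A''` are variables with equations because A[σ][τ] and A[τ ≫ σ] are equal
only propositionally; this avoids casts between their context extensions. -/
theorem lift_comp {σ : Δ ⟶ Γ} {τ : Θ ⟶ Δ} {ρ : Θ ⟶ Γ} (e : τ ≫ σ = ρ) (A : M.Types Γ)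
    (A' : M.Types Δ) (A'' : M.Types Θ) (h : A' = tySub A σ) (h' : A'' = tySub A' τ)
    (h'' : A'' = tySub A ρ) : M.lift τ A' A'' h' ≫ M.lift σ A A' h = M.lift ρ A A'' h'' := by
  subst e
  apply M.hom_ext
  · rw [Category.assoc, M.lift_wk, ← Category.assoc, M.lift_wk, M.lift_wk, Category.assoc]
  · rw [tmSub_comp, M.var_lift, M.var_lift, M.var_lift]

theorem inst_comp_lift (σ : Δ ⟶ Γ) (A : M.Types Γ) (A' : M.Types Δ) (h : A' = tySub A σ)
    (a : M.Terms Δ) (ha : tp a = A') :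
    M.inst A' a ha ≫ M.lift σ A A' h = M.pair A σ a (ha.trans h) := by
  apply M.hom_ext
  · rw [Category.assoc, M.lift_wk, M.pair_wk, ← Category.assoc, M.inst_wk, Category.id_comp]
  · rw [tmSub_comp, M.var_lift, M.var_inst, M.var_pair]

theorem tySub_inst (A : M.Types Γ) (B : M.Types (M.ext A)) {σ : Δ ⟶ Γ} {A' : M.Types Δ}
    (h : A' = tySub A σ) (a : M.Terms Δ) (ha : tp a = A') :
    tySub (tySub B (M.lift σ A A' h)) (M.inst A' a ha) = tySub B (M.pair A σ a (ha.trans h)) := by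
  rw [← tySub_comp, inst_comp_lift]

/-- Context extension turns substitution in types into pullback of display maps. -/
theorem isPullback_lift (σ : Δ ⟶ Γ) (A : M.Types Γ) (A' : M.Types Δ) (h : A' = tySub A σ) :
    IsPullback (M.wk A') (M.lift σ A A' h) σ (M.wk A) := by
  refine ⟨⟨(M.lift_wk σ A A' h).symm⟩, ⟨Limits.PullbackCone.IsLimit.mk _
    (fun s => M.pair A' s.fst (tmSub (M.var A) s.snd) ?_) (fun s => M.pair_wk _ _ _ _)
    (fun s => ?_) (fun s m h₁ h₂ => ?_)⟩⟩
  · rw [tp_tmSub, M.tp_var, ← tySub_comp, ← s.condition, tySub_comp, h]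
  · apply M.hom_ext
    · rw [Category.assoc, M.lift_wk, ← Category.assoc, M.pair_wk, s.condition]
    · rw [tmSub_comp, M.var_lift, M.var_pair]
  · apply M.hom_ext
    · rw [M.pair_wk, h₁]
    · rw [M.var_pair, ← h₂, tmSub_comp, M.var_lift]

theorem toSection_bijective (A : M.Types Γ) : Function.Bijective (M.toSection A) := by
  constructor
  · intro a b h
    apply Subtype.ext
    rw [← M.var_inst A a.1 a.2, ← M.var_inst A b.1 b.2]
    exact congrArg (tmSub (M.var A)) (congrArg Subtype.val h)
  · rintro ⟨s, hs⟩
    have h : tp (tmSub (M.var A) s) = A := by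
      rw [tp_tmSub, M.tp_var, ← tySub_comp, hs, tySub_id]
    refine ⟨⟨tmSub (M.var A) s, h⟩, Subtype.ext ?_⟩
    apply M.hom_ext
    · exact (M.inst_wk A _ h).trans hs.symm
    · exact M.var_inst A _ h

/-- Full faithfulness is the universal property of context extension; only essential surjectivity
uses `h`. -/
theorem display_isEquivalence (D : MorphismProperty C)
    (hD : ∀ (Γ : C) (A : M.Types Γ), D (M.wk A)) (Γ : C)
    (h : ∀ {E : C} (d : E ⟶ Γ), D d → ∃ (A : M.Types Γ) (e : M.ext A ≅ E), e.hom ≫ d = M.wk A) :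
    (M.display D hD Γ).IsEquivalence where
  faithful := ⟨fun {A B f g} hfg => by
    have h₁ : M.termMap A.type B.type f = M.termMap A.type B.type g :=
      congrArg (fun k => k.left) hfg
    apply Subtype.ext
    rw [← M.var_termMap A.type B.type f, ← M.var_termMap A.type B.type g, h₁]⟩
  full := ⟨fun {A B} k => by
    obtain ⟨l, hl⟩ : ∃ l : M.ext A.type ⟶ M.ext B.type, l = k.left := ⟨_, rfl⟩
    have hk : l ≫ M.wk B.type = M.wk A.type := hl ▸ MorphismProperty.Over.w k
    refine ⟨⟨tmSub (M.var B.type) l, ?_⟩, ?_⟩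
    · rw [tp_tmSub, M.tp_var, ← tySub_comp, hk]
    · apply MorphismProperty.Over.Hom.ext
      refine Eq.trans ?_ hl
      apply M.hom_ext
      · exact (M.termMap_wk A.type B.type _).trans hk.symm
      · exact M.var_termMap A.type B.type _⟩
  essSurj := ⟨fun X => by
    obtain ⟨A, e, he⟩ := h X.hom X.prop
    exact ⟨⟨A⟩, ⟨MorphismProperty.Over.isoMk e he⟩⟩⟩

namespace IdIntro

variable {M} (I : M.IdIntro)

/-- The substitution `Δ.A'.A' ⟶ Γ.A.A` over `σ : Δ ⟶ Γ`, where `A' = A[σ]`. -/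
def liftSq (σ : Δ ⟶ Γ) (A : M.Types Γ) (A' : M.Types Δ) (h : A' = tySub A σ) :
    M.ext (tySub A' (M.wk A')) ⟶ M.ext (tySub A (M.wk A)) :=
  M.lift (M.lift σ A A' h) (tySub A (M.wk A)) (tySub A' (M.wk A'))
    (by rw [← tySub_comp, M.lift_wk, tySub_comp, h])

theorem gen_liftSq (σ : Δ ⟶ Γ) (A : M.Types Γ) (A' : M.Types Δ) (h : A' = tySub A σ) :
    I.gen A' = tySub (I.gen A) (liftSq σ A A' h) := by
  subst h
  exact I.gen_sub σ A

/-- The substitution `Δ.A'.A'.Id_A' ⟶ Γ.A.A.Id_A` over `σ : Δ ⟶ Γ`, where `A' = A[σ]`. -/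
def liftCtx (σ : Δ ⟶ Γ) (A : M.Types Γ) (A' : M.Types Δ) (h : A' = tySub A σ) :
    I.ctx A' ⟶ I.ctx A :=
  M.lift (liftSq σ A A' h) (I.gen A) _ (I.gen_liftSq σ A A' h)

/-- The projection `Γ.A.A.Id_A ⟶ Γ`. -/
def wkCtx (A : M.Types Γ) : I.ctx A ⟶ Γ :=
  M.wk (I.gen A) ≫ M.wk (tySub A (M.wk A)) ≫ M.wk A

theorem rho_liftCtx (σ : Δ ⟶ Γ) (A : M.Types Γ) (A' : M.Types Δ) (h : A' = tySub A σ) :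
    I.rho A' ≫ I.liftCtx σ A A' h = M.lift σ A A' h ≫ I.rho A := by
  subst h
  exact I.rho_lift₃ σ A

theorem rho_wkCtx (A : M.Types Γ) : I.rho A ≫ I.wkCtx A = M.wk A := by
  rw [rho, wkCtx, ← Category.assoc, M.pair_wk, ← Category.assoc, M.inst_wk, Category.id_comp]

theorem liftCtx_comp {σ : Δ ⟶ Γ} {τ : Θ ⟶ Δ} {ρ : Θ ⟶ Γ} (e : τ ≫ σ = ρ) (A : M.Types Γ)
    (A' : M.Types Δ) (A'' : M.Types Θ) (h : A' = tySub A σ) (h' : A'' = tySub A' τ)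
    (h'' : A'' = tySub A ρ) :
    I.liftCtx τ A' A'' h' ≫ I.liftCtx σ A A' h = I.liftCtx ρ A A'' h'' :=
  M.lift_comp (M.lift_comp (M.lift_comp e _ _ _ _ _ _) _ _ _ _ _ _) _ _ _ _ _ _

/-- Three context-extension squares are pasted, one for each of A, A and Id_A. -/
theorem isPullback_liftCtx (σ : Δ ⟶ Γ) (A : M.Types Γ) (A' : M.Types Δ) (h : A' = tySub A σ) :
    IsPullback (I.wkCtx A') (I.liftCtx σ A A' h) σ (I.wkCtx A) :=
  (((M.isPullback_lift _ (I.gen A) _ (I.gen_liftSq σ A A' h)).flip.paste_vert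
    ((M.isPullback_lift _ (tySub A (M.wk A)) (tySub A' (M.wk A')) _).flip.paste_vert
      (M.isPullback_lift σ A A' h).flip))).flip

/-- The reflexivity substitution of `A[σ]` is the pullback of that of `A`. -/
theorem isPullback_rho (σ : Δ ⟶ Γ) (A : M.Types Γ) (A' : M.Types Δ) (h : A' = tySub A σ) :
    IsPullback (I.rho A') (M.lift σ A A' h) (I.liftCtx σ A A' h) (I.rho A) := by
  have h₁ := (M.isPullback_lift σ A A' h).flip
  rw [← I.rho_wkCtx A, ← I.rho_wkCtx A'] at h₁
  -- Since ρ followed by the projection to the base context is the display map, the outer rectangle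
  -- and the lower square are pullbacks; hence so is the upper one.
  exact (IsPullback.of_bot h₁ (I.rho_liftCtx σ A A' h).symm
    (I.isPullback_liftCtx σ A A' h).flip).flip

end IdIntro

end CwF

/-! ### The local universes model -/

/-- A local universe: a map of `D`, considered as a family of small types over its codomain. -/
structure LocalUniverse {C : Type u} [Category.{v} C] (D : MorphismProperty C) where
  base : C
  total : C
  map : total ⟶ base
  mem : D map

namespace LocalUniverse

variable {C : Type u} [Category.{v} C] (D : MorphismProperty C)

/-- The coproduct of the presheaves represented by the objects `X U`. -/
def coproductPresheaf (X : LocalUniverse D → C) : Cᵒᵖ ⥤ Type max u v where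
  obj Γ := Σ U, (Γ.unop ⟶ X U)
  map σ := TypeCat.ofHom fun x => ⟨x.1, σ.unop ≫ x.2⟩
  map_id Γ := ConcreteCategory.hom_ext _ _ <| by
    rintro ⟨U, f⟩
    exact congrArg (Sigma.mk (β := fun U => (Γ.unop ⟶ X U)) U) (Category.id_comp f)
  map_comp {_ _ Γ} σ τ := ConcreteCategory.hom_ext _ _ <| by
    rintro ⟨U, f⟩
    exact congrArg (Sigma.mk (β := fun U => (Γ.unop ⟶ X U)) U) (Category.assoc τ.unop σ.unop f)

/-- A type in context `Γ` is a local universe with a map from `Γ` to its base; a term is a local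
universe with a map from `Γ` to its total space. -/
def typesAndTerms : TypesAndTerms.{max u v} C where
  Ty := coproductPresheaf D base
  Tm := coproductPresheaf D total
  typing :=
    { app := fun _ => TypeCat.ofHom fun a => ⟨a.1, a.2 ≫ a.1.map⟩
      naturality := fun _ Γ σ => ConcreteCategory.hom_ext _ _ <| by
        rintro ⟨U, p⟩
        exact congrArg (Sigma.mk (β := fun U => (Γ.unop ⟶ base U)) U)
          (Category.assoc σ.unop p U.map) }

variable {D} {Γ Δ : C}

/-- The local universe of a type. -/
def code (A : (typesAndTerms D).Types Γ) : LocalUniverse D :=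
  Sigma.fst (β := fun U : LocalUniverse D => (Γ ⟶ U.base)) A

/-- The map naming a type in its local universe. -/
def name (A : (typesAndTerms D).Types Γ) : Γ ⟶ (code A).base :=
  Sigma.snd (β := fun U : LocalUniverse D => (Γ ⟶ U.base)) A

/-- The type named by a map into the base of a local universe. -/
def ofName (U : LocalUniverse D) (f : Γ ⟶ U.base) : (typesAndTerms D).Types Γ :=
  Sigma.mk (β := fun U : LocalUniverse D => (Γ ⟶ U.base)) U f

/-- The term given by a map into the total space of a local universe. -/
def ofPoint (U : LocalUniverse D) (a : Γ ⟶ U.total) : (typesAndTerms D).Terms Γ :=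
  Sigma.mk (β := fun U : LocalUniverse D => (Γ ⟶ U.total)) U a

theorem tmSub_ofPoint (U : LocalUniverse D) (a : Γ ⟶ U.total) (σ : Δ ⟶ Γ) :
    tmSub (ofPoint U a) σ = ofPoint U (σ ≫ a) := rfl

theorem ofName_injective (U : LocalUniverse D) {f g : Γ ⟶ U.base} (h : ofName U f = ofName U g) :
    f = g := eq_of_heq (Sigma.mk.inj h).2

theorem ofPoint_injective (U : LocalUniverse D) {f g : Γ ⟶ U.total}
    (h : ofPoint U f = ofPoint U g) : f = g := eq_of_heq (Sigma.mk.inj h).2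

/-- The typing map keeps the local universe of a term, so an equation between types identifies the
local universes. Stating this existentially keeps the resulting cast out of `point`. -/
theorem exists_point (a : (typesAndTerms D).Terms Γ) (U : LocalUniverse D) (f : Γ ⟶ U.base)
    (h : tp a = ofName U f) : ∃ p : Γ ⟶ U.total, p ≫ U.map = f ∧ ofPoint U p = a := by
  obtain ⟨V, p⟩ : Σ V : LocalUniverse D, (Γ ⟶ V.total) := a
  obtain rfl : V = U := congrArg code h
  exact ⟨p, ofName_injective _ h, rfl⟩

/-- The map into the total space of a local universe underlying a term of a type in it. -/
noncomputable def point (a : (typesAndTerms D).Terms Γ) (U : LocalUniverse D) (f : Γ ⟶ U.base)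
    (h : tp a = ofName U f) : Γ ⟶ U.total := (exists_point a U f h).choose

theorem point_map (a : (typesAndTerms D).Terms Γ) (U : LocalUniverse D) (f : Γ ⟶ U.base)
    (h : tp a = ofName U f) : point a U f h ≫ U.map = f := (exists_point a U f h).choose_spec.1

theorem ofPoint_point (a : (typesAndTerms D).Terms Γ) (U : LocalUniverse D) (f : Γ ⟶ U.base)
    (h : tp a = ofName U f) : ofPoint U (point a U f h) = a := (exists_point a U f h).choose_spec.2

instance [D.HasPullbacks] (U : LocalUniverse D) (f : Γ ⟶ U.base) :
    Limits.HasPullback U.map f :=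
  MorphismProperty.HasPullbacks.hasPullback f U.mem

variable (D)

/-- The category with families of types in the local universes of `D`. -/
noncomputable def cwf [D.HasPullbacks] [Limits.HasTerminal C] : CwF.{max u v} C where
  toTypesAndTerms := typesAndTerms D
  empty := ⊤_ C
  emptyIsTerminal := Limits.terminalIsTerminal
  ext A := Limits.pullback (code A).map (name A)
  wk A := Limits.pullback.snd (code A).map (name A)
  var A := ofPoint (code A) (Limits.pullback.fst (code A).map (name A))
  tp_var A := congrArg (ofName (code A)) 
    (Limits.pullback.condition (f := (code A).map) (g := name A))
  pair A σ a h := Limits.pullback.lift (point a (code A) (σ ≫ name A) h) σ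
    (point_map a (code A) (σ ≫ name A) h)
  pair_wk A σ a h := Limits.pullback.lift_snd _ _ _
  var_pair A σ a h := by
    rw [tmSub_ofPoint, Limits.pullback.lift_fst]
    exact ofPoint_point a (code A) (σ ≫ name A) h
  pair_eta A τ := by
    apply Limits.pullback.hom_ext
    · rw [Limits.pullback.lift_fst]
      apply ofPoint_injective
      exact ofPoint_point _ _ _ _
    · rw [Limits.pullback.lift_snd]

variable {D}

theorem exists_isPullback_wk [D.HasPullbacks] [Limits.HasTerminal C] (U : LocalUniverse D)
    (f : Γ ⟶ U.base) :
    ∃ p : (cwf D).ext (ofName U f) ⟶ U.total, IsPullback p ((cwf D).wk (ofName U f)) U.map f :=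
  ⟨Limits.pullback.fst U.map f, IsPullback.of_hasPullback U.map f⟩

theorem wk_mem [D.HasPullbacks] [D.IsStableUnderBaseChange] [Limits.HasTerminal C]
    (A : (cwf D).Types Γ) : D ((cwf D).wk A) :=
  MorphismProperty.pullback_snd (P := D) _ _ (code A).mem

/-- The map `d` is its own local universe, named by the identity of Γ, and a pullback along an
identity changes nothing up to isomorphism. -/
theorem exists_ext_iso [D.HasPullbacks] [Limits.HasTerminal C] {E : C} (d : E ⟶ Γ) (hd : D d) :
    ∃ (A : (cwf D).Types Γ) (e : (cwf D).ext A ≅ E), e.hom ≫ d = (cwf D).wk A := by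
  obtain ⟨p, hp⟩ := exists_isPullback_wk (D := D) ⟨Γ, E, d, hd⟩ (𝟙 Γ)
  have : IsIso p := hp.isIso_fst_of_isIso
  exact ⟨_, asIso p, hp.w.trans (Category.comp_id _)⟩

end LocalUniverse

/-! ### Generic pairs of types and dependent sums -/

namespace CwF

variable {C : Type u} [Category.{v} C] {M : CwF.{w} C} {Γ Δ Θ : C}

variable (M) in
/-- A family of generic pairs of a type `A` in context `Γ` and a type `B` in context `Γ.A`, from
which every such pair arises by substitution, in a way that is stable under substitution. -/
structure PairClassifier where
  Idx : Type x
  obj : Idx → C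
  fst : ∀ k, M.Types (obj k)
  snd : ∀ k, M.Types (M.ext (fst k))
  map : ∀ {Γ : C} (A : M.Types Γ), M.Types (M.ext A) → Σ k, (Γ ⟶ obj k)
  map_fst : ∀ {Γ : C} (A : M.Types Γ) (B : M.Types (M.ext A)),
    A = tySub (fst (map A B).1) (map A B).2
  map_snd : ∀ {Γ : C} (A : M.Types Γ) (B : M.Types (M.ext A)),
    B = tySub (snd (map A B).1) (M.lift (map A B).2 _ A (map_fst A B))
  map_sub : ∀ {Γ Δ : C} (σ : Δ ⟶ Γ) (A : M.Types Γ) (B : M.Types (M.ext A)),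
    map (tySub A σ) (tySub B (M.lift σ A _ rfl)) = ⟨(map A B).1, σ ≫ (map A B).2⟩

namespace PairClassifier

variable (K : M.PairClassifier)

/-- Converts typing hypotheses about B[a] into hypotheses about the generic pair, where the
constructions take place. -/
theorem tySub_inst (A : M.Types Γ) (B : M.Types (M.ext A)) (a : M.Terms Γ) (ha : tp a = A) :
    tySub B (M.inst A a ha) =
      tySub (K.snd (K.map A B).1)
        (M.pair (K.fst (K.map A B).1) (K.map A B).2 a (ha.trans (K.map_fst A B))) :=
  (congrArg (fun B' => tySub B' (M.inst A a ha)) (K.map_snd A B)).trans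
    (M.tySub_inst _ _ (K.map_fst A B) a ha)

/-- Types over the contexts of the generic pairs whose extensions are the iterated extensions. -/
structure Sums where
  sig : ∀ k, M.Types (K.obj k)
  iso : ∀ k, M.ext (sig k) ≅ M.ext (K.snd k)
  iso_wk : ∀ k, (iso k).hom ≫ M.wk (K.snd k) ≫ M.wk (K.fst k) = M.wk (sig k)

namespace Sums

variable {K} (S : K.Sums)

/-- Pairing for an instance of a generic pair of types. -/
def pr (x : Σ k, (Γ ⟶ K.obj k)) (a b : M.Terms Γ) (ha : tp a = tySub (K.fst x.1) x.2)
    (hb : tp b = tySub (K.snd x.1) (M.pair (K.fst x.1) x.2 a ha)) : M.Terms Γ :=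
  tmSub (M.var (S.sig x.1))
    (M.pair (K.snd x.1) (M.pair (K.fst x.1) x.2 a ha) b hb ≫ (S.iso x.1).inv)

theorem iso_inv_wk (k : K.Idx) :
    (S.iso k).inv ≫ M.wk (S.sig k) = M.wk (K.snd k) ≫ M.wk (K.fst k) := by
  rw [← S.iso_wk k, Iso.inv_hom_id_assoc]

theorem tp_pr (x : Σ k, (Γ ⟶ K.obj k)) (a b : M.Terms Γ) (ha : tp a = tySub (K.fst x.1) x.2)
    (hb : tp b = tySub (K.snd x.1) (M.pair (K.fst x.1) x.2 a ha)) :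
    tp (S.pr x a b ha hb) = tySub (S.sig x.1) x.2 := by
  rw [pr, tp_tmSub, M.tp_var, ← tySub_comp, Category.assoc, iso_inv_wk, ← Category.assoc,
    M.pair_wk, M.pair_wk]

theorem pr_congr {x y : Σ k, (Γ ⟶ K.obj k)} {a a' b b' : M.Terms Γ} (hx : x = y) (e : a = a')
    (e' : b = b') (ha : tp a = tySub (K.fst x.1) x.2)
    (hb : tp b = tySub (K.snd x.1) (M.pair (K.fst x.1) x.2 a ha))
    (ha' : tp a' = tySub (K.fst y.1) y.2)
    (hb' : tp b' = tySub (K.snd y.1) (M.pair (K.fst y.1) y.2 a' ha')) :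
    S.pr x a b ha hb = S.pr y a' b' ha' hb' := by
  subst hx e e'; rfl

theorem pr_sub (σ : Δ ⟶ Γ) (x : Σ k, (Γ ⟶ K.obj k)) (a b : M.Terms Γ)
    (ha : tp a = tySub (K.fst x.1) x.2)
    (hb : tp b = tySub (K.snd x.1) (M.pair (K.fst x.1) x.2 a ha))
    (ha' : tp (tmSub a σ) = tySub (K.fst x.1) (σ ≫ x.2))
    (hb' : tp (tmSub b σ) = tySub (K.snd x.1) (M.pair (K.fst x.1) (σ ≫ x.2) (tmSub a σ) ha')) :
    tmSub (S.pr x a b ha hb) σ = S.pr ⟨x.1, σ ≫ x.2⟩ (tmSub a σ) (tmSub b σ) ha' hb' := by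
  rw [pr, pr, ← tmSub_comp, ← Category.assoc]
  congr 2
  rw [M.comp_pair σ (K.snd x.1) _ b hb ((M.tp_sub_eq hb σ).trans (tySub_comp _ _ _).symm)]
  exact M.pair_congr _ (M.comp_pair σ _ _ _ _ _) rfl _ _

/-- The point of the iterated extension given by a term of a sum. -/
def unpair (x : Σ k, (Γ ⟶ K.obj k)) (c : M.Terms Γ) (hc : tp c = tySub (S.sig x.1) x.2) :
    Γ ⟶ M.ext (K.snd x.1) :=
  M.pair (S.sig x.1) x.2 c hc ≫ (S.iso x.1).hom

theorem unpair_wk_wk (x : Σ k, (Γ ⟶ K.obj k)) (c : M.Terms Γ)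
    (hc : tp c = tySub (S.sig x.1) x.2) :
    (S.unpair x c hc ≫ M.wk (K.snd x.1)) ≫ M.wk (K.fst x.1) = x.2 := by
  rw [unpair, Category.assoc, Category.assoc, S.iso_wk, M.pair_wk]

/-- The family `X` is arbitrary so that both projections are covered; `y` is a variable so that
`map_sub` can be supplied as `hy` without rewriting in dependent types. -/
theorem tmSub_unpair (σ : Δ ⟶ Γ) {x : Σ k, (Γ ⟶ K.obj k)} (c : M.Terms Γ)
    (hc : tp c = tySub (S.sig x.1) x.2) {X : ∀ k, M.Terms (M.ext (K.snd k))}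
    {y : Σ k, (Δ ⟶ K.obj k)} (hy : y = ⟨x.1, σ ≫ x.2⟩)
    (hc' : tp (tmSub c σ) = tySub (S.sig y.1) y.2) :
    tmSub (tmSub (X x.1) (S.unpair x c hc)) σ = tmSub (X y.1) (S.unpair y (tmSub c σ) hc') := by
  subst hy
  rw [← tmSub_comp, unpair, ← Category.assoc, M.comp_pair σ (S.sig x.1) _ c hc hc', unpair]

theorem unpair_pr (x : Σ k, (Γ ⟶ K.obj k)) (a b : M.Terms Γ)
    (ha : tp a = tySub (K.fst x.1) x.2)
    (hb : tp b = tySub (K.snd x.1) (M.pair (K.fst x.1) x.2 a ha))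
    (h : tp (S.pr x a b ha hb) = tySub (S.sig x.1) x.2) :
    S.unpair x (S.pr x a b ha hb) h = M.pair (K.snd x.1) (M.pair (K.fst x.1) x.2 a ha) b hb := by
  rw [unpair, ← Iso.eq_comp_inv]
  apply M.hom_ext
  · rw [M.pair_wk, Category.assoc, iso_inv_wk, ← Category.assoc, M.pair_wk, M.pair_wk]
  · rw [M.var_pair, pr]

theorem pair_unpair (x : Σ k, (Γ ⟶ K.obj k)) (c : M.Terms Γ) (hc : tp c = tySub (S.sig x.1) x.2)
    (ha : tp (tmSub (M.var (K.fst x.1)) (S.unpair x c hc ≫ M.wk (K.snd x.1))) =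
      tySub (K.fst x.1) x.2) :
    M.pair (K.fst x.1) x.2 _ ha = S.unpair x c hc ≫ M.wk (K.snd x.1) := by
  apply M.hom_ext
  · rw [M.pair_wk, unpair_wk_wk]
  · rw [M.var_pair]

theorem pr_unpair (x : Σ k, (Γ ⟶ K.obj k)) (c : M.Terms Γ) (hc : tp c = tySub (S.sig x.1) x.2)
    (ha : tp (tmSub (M.var (K.fst x.1)) (S.unpair x c hc ≫ M.wk (K.snd x.1))) =
      tySub (K.fst x.1) x.2)
    (hb : tp (tmSub (M.var (K.snd x.1)) (S.unpair x c hc)) =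
      tySub (K.snd x.1) (M.pair (K.fst x.1) x.2 _ ha)) :
    S.pr x _ _ ha hb = c := by
  have h : M.pair (K.snd x.1) (M.pair (K.fst x.1) x.2 _ ha) _ hb = S.unpair x c hc := by
    apply M.hom_ext
    · rw [M.pair_wk, pair_unpair]
    · rw [M.var_pair]
  rw [pr, h, unpair, Category.assoc, Iso.hom_inv_id, Category.comp_id, M.var_pair]

/-- Dependent sums from dependent sums of the generic pairs. -/
def sigmaTypes : M.SigmaTypes where
  Sig A B := tySub (S.sig (K.map A B).1) (K.map A B).2
  Sig_sub σ A B := by rw [K.map_sub, tySub_comp]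
  pr A B a b ha hb := S.pr (K.map A B) a b (ha.trans (K.map_fst A B))
    (hb.trans (K.tySub_inst A B a ha))
  tp_pr A B a b ha hb := S.tp_pr _ _ _ _ _
  fst A B c hc := tmSub (tmSub (M.var (K.fst (K.map A B).1)) (M.wk (K.snd (K.map A B).1)))
    (S.unpair (K.map A B) c hc)
  tp_fst A B c hc := by
    rw [← tmSub_comp, tp_tmSub, M.tp_var, ← tySub_comp, unpair_wk_wk]
    exact (K.map_fst A B).symm
  snd A B c hc := tmSub (M.var (K.snd (K.map A B).1)) (S.unpair (K.map A B) c hc)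
  tp_snd A B c hc := by
    rw [K.tySub_inst, tp_tmSub, M.tp_var, ← tySub_comp]
    congr 1
    apply M.hom_ext
    · rw [M.pair_wk, unpair_wk_wk]
    · rw [M.var_pair, tmSub_comp]
  fst_pr A B a b ha hb := by
    rw [unpair_pr, ← tmSub_comp, M.pair_wk, M.var_pair]
  snd_pr A B a b ha hb := by
    rw [unpair_pr, M.var_pair]
  pr_eta A B c hc := by
    refine (S.pr_congr rfl (tmSub_comp _ _ _).symm rfl _ _ ?_ ?_).trans (S.pr_unpair _ c hc ?_ ?_)
    all_goals
      first
      | rw [tp_tmSub, M.tp_var, ← tySub_comp, unpair_wk_wk]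
      | rw [pair_unpair, tp_tmSub, M.tp_var, ← tySub_comp]
  pr_sub σ A B a b ha hb := by
    rw [S.pr_sub σ (K.map A B) a b _ _
      ((M.tp_sub_eq (ha.trans (K.map_fst A B)) σ).trans (tySub_comp _ _ _).symm)
      (by
        rw [M.tp_sub_eq (hb.trans (K.tySub_inst A B a ha)) σ, ← tySub_comp]
        congr 1
        exact M.comp_pair _ _ _ _ _ _)]
    exact S.pr_congr (K.map_sub σ A B).symm rfl rfl _ _ _ _
  fst_sub σ A B c hc := S.tmSub_unpair σ c hc
    (X := fun k => tmSub (M.var (K.fst k)) (M.wk (K.snd k))) (K.map_sub σ A B) _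
  snd_sub σ A B c hc := S.tmSub_unpair σ c hc (X := fun k => M.var (K.snd k)) (K.map_sub σ A B) _

end Sums

end PairClassifier

end CwF

/-! ### Dependent products from generic ones -/

namespace CwF

variable {C : Type u} [Category.{v} C] {M : CwF.{w} C} {Γ Δ Θ : C}

namespace PairClassifier

variable (K : M.PairClassifier)

/-- Types over the contexts of the generic pairs whose extensions are dependent products of the
display maps of the pairs. -/
structure Products where
  pi : ∀ k, M.Types (K.obj k)
  ev : ∀ k, M.ext (tySub (K.fst k) (M.wk (pi k))) ⟶ M.ext (K.snd k)
  ev_wk : ∀ k, ev k ≫ M.wk (K.snd k) = M.lift (M.wk (pi k)) (K.fst k) _ rfl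
  existsUnique : ∀ {Δ : C} (x : Σ k, (Δ ⟶ K.obj k)) (A : M.Types Δ)
    (h : A = tySub (K.fst x.1) x.2) (g : M.ext A ⟶ M.ext (K.snd x.1)),
    g ≫ M.wk (K.snd x.1) = M.lift x.2 (K.fst x.1) A h →
      ∃! c : Δ ⟶ M.ext (pi x.1), c ≫ M.wk (pi x.1) = x.2 ∧
        ∀ h', M.lift c (tySub (K.fst x.1) (M.wk (pi x.1))) A h' ≫ ev x.1 = g

namespace Products

variable {K} (S : K.Products)

/-- The transpose of a map `Γ.A ⟶ B'` to the generic `B'`. -/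
noncomputable def curry (x : Σ k, (Γ ⟶ K.obj k)) (A : M.Types Γ) (h : A = tySub (K.fst x.1) x.2)
    (g : M.ext A ⟶ M.ext (K.snd x.1))
    (hg : g ≫ M.wk (K.snd x.1) = M.lift x.2 (K.fst x.1) A h) : Γ ⟶ M.ext (S.pi x.1) :=
  (S.existsUnique x A h g hg).choose

theorem curry_wk (x : Σ k, (Γ ⟶ K.obj k)) (A : M.Types Γ) (h : A = tySub (K.fst x.1) x.2)
    (g : M.ext A ⟶ M.ext (K.snd x.1))
    (hg : g ≫ M.wk (K.snd x.1) = M.lift x.2 (K.fst x.1) A h) :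
    S.curry x A h g hg ≫ M.wk (S.pi x.1) = x.2 :=
  (S.existsUnique x A h g hg).choose_spec.1.1

theorem lift_curry_ev (x : Σ k, (Γ ⟶ K.obj k)) (A : M.Types Γ) (h : A = tySub (K.fst x.1) x.2)
    (g : M.ext A ⟶ M.ext (K.snd x.1))
    (hg : g ≫ M.wk (K.snd x.1) = M.lift x.2 (K.fst x.1) A h)
    (h' : A = tySub (tySub (K.fst x.1) (M.wk (S.pi x.1))) (S.curry x A h g hg)) :
    M.lift (S.curry x A h g hg) (tySub (K.fst x.1) (M.wk (S.pi x.1))) A h' ≫ S.ev x.1 = g :=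
  (S.existsUnique x A h g hg).choose_spec.1.2 h'

theorem eq_curry (x : Σ k, (Γ ⟶ K.obj k)) (A : M.Types Γ) (h : A = tySub (K.fst x.1) x.2)
    (g : M.ext A ⟶ M.ext (K.snd x.1))
    (hg : g ≫ M.wk (K.snd x.1) = M.lift x.2 (K.fst x.1) A h) (c : Γ ⟶ M.ext (S.pi x.1))
    (hc : c ≫ M.wk (S.pi x.1) = x.2)
    (hc' : ∀ h', M.lift c (tySub (K.fst x.1) (M.wk (S.pi x.1))) A h' ≫ S.ev x.1 = g) :
    c = S.curry x A h g hg :=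
  (S.existsUnique x A h g hg).choose_spec.2 c ⟨hc, hc'⟩

/-- Abstraction for an instance of a generic pair of types. -/
noncomputable def lam (x : Σ k, (Γ ⟶ K.obj k)) (A : M.Types Γ) (h : A = tySub (K.fst x.1) x.2)
    (b : M.Terms (M.ext A)) (hb : tp b = tySub (K.snd x.1) (M.lift x.2 (K.fst x.1) A h)) :
    M.Terms Γ :=
  tmSub (M.var (S.pi x.1)) (S.curry x A h (M.pair (K.snd x.1) _ b hb) (M.pair_wk _ _ _ _))

theorem tp_lam (x : Σ k, (Γ ⟶ K.obj k)) (A : M.Types Γ) (h : A = tySub (K.fst x.1) x.2)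
    (b : M.Terms (M.ext A)) (hb : tp b = tySub (K.snd x.1) (M.lift x.2 (K.fst x.1) A h)) :
    tp (S.lam x A h b hb) = tySub (S.pi x.1) x.2 := by
  rw [lam, tp_tmSub, M.tp_var, ← tySub_comp, curry_wk]

theorem pair_lam (x : Σ k, (Γ ⟶ K.obj k)) (A : M.Types Γ) (h : A = tySub (K.fst x.1) x.2)
    (b : M.Terms (M.ext A)) (hb : tp b = tySub (K.snd x.1) (M.lift x.2 (K.fst x.1) A h))
    (hf : tp (S.lam x A h b hb) = tySub (S.pi x.1) x.2) :
    M.pair (S.pi x.1) x.2 _ hf =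
      S.curry x A h (M.pair (K.snd x.1) _ b hb) (M.pair_wk _ _ _ _) := by
  apply M.hom_ext
  · rw [M.pair_wk, curry_wk]
  · rw [M.var_pair, lam]

/-- Transposition is natural in the context because the transpose is unique: `σ` followed by the
transpose of `b` has the property that characterizes the transpose of the substituted `b`. -/
theorem lam_sub (σ : Δ ⟶ Γ) (x : Σ k, (Γ ⟶ K.obj k)) (y : Σ k, (Δ ⟶ K.obj k))
    (e : y = ⟨x.1, σ ≫ x.2⟩) (A : M.Types Γ) (A' : M.Types Δ) (hA : A' = tySub A σ)
    (h : A = tySub (K.fst x.1) x.2) (h' : A' = tySub (K.fst y.1) y.2)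
    (b : M.Terms (M.ext A)) (hb : tp b = tySub (K.snd x.1) (M.lift x.2 (K.fst x.1) A h))
    (hb' : tp (tmSub b (M.lift σ A A' hA)) =
      tySub (K.snd y.1) (M.lift y.2 (K.fst y.1) A' h')) :
    tmSub (S.lam x A h b hb) σ = S.lam y A' h' (tmSub b (M.lift σ A A' hA)) hb' := by
  subst e
  rw [lam, lam, ← tmSub_comp]
  congr 1
  apply S.eq_curry ⟨x.1, σ ≫ x.2⟩
  · rw [Category.assoc, curry_wk]
  · intro h''
    have e₁ : A = tySub (tySub (K.fst x.1) (M.wk (S.pi x.1)))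
        (S.curry x A h (M.pair (K.snd x.1) _ b hb) (M.pair_wk _ _ _ _)) := by
      rw [← tySub_comp, curry_wk, h]
    have e₂ := M.lift_comp (σ := S.curry x A h (M.pair (K.snd x.1) _ b hb) (M.pair_wk _ _ _ _))
      (τ := σ) rfl _ A A' e₁ hA h''
    rw [← e₂, Category.assoc, lift_curry_ev]
    have e₃ := M.lift_comp (σ := x.2) (τ := σ) rfl (K.fst x.1) A A' h hA h'
    rw [M.comp_pair (M.lift σ A A' hA) (K.snd x.1) _ b hb (by rw [hb', e₃])]
    exact M.pair_congr _ e₃ rfl _ _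

theorem fst_eq_sub_pair (x : Σ k, (Γ ⟶ K.obj k)) {A : M.Types Γ} (h : A = tySub (K.fst x.1) x.2)
    (f : M.Terms Γ) (hf : tp f = tySub (S.pi x.1) x.2) :
    A = tySub (tySub (K.fst x.1) (M.wk (S.pi x.1))) (M.pair (S.pi x.1) x.2 f hf) := by
  rw [← tySub_comp, M.pair_wk, h]

/-- The map `Γ.A ⟶ B'` to the generic `B'` given by a term of a dependent product. -/
def uncurry (x : Σ k, (Γ ⟶ K.obj k)) (A : M.Types Γ) (h : A = tySub (K.fst x.1) x.2)
    (f : M.Terms Γ) (hf : tp f = tySub (S.pi x.1) x.2) : M.ext A ⟶ M.ext (K.snd x.1) :=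
  M.lift (M.pair (S.pi x.1) x.2 f hf) _ A (S.fst_eq_sub_pair x h f hf) ≫ S.ev x.1

theorem uncurry_wk (x : Σ k, (Γ ⟶ K.obj k)) (A : M.Types Γ) (h : A = tySub (K.fst x.1) x.2)
    (f : M.Terms Γ) (hf : tp f = tySub (S.pi x.1) x.2) :
    S.uncurry x A h f hf ≫ M.wk (K.snd x.1) = M.lift x.2 (K.fst x.1) A h := by
  rw [uncurry, Category.assoc, S.ev_wk]
  exact M.lift_comp (M.pair_wk _ _ _ _) _ _ _ _ _ _

theorem lift_uncurry (σ : Δ ⟶ Γ) (x : Σ k, (Γ ⟶ K.obj k)) (A : M.Types Γ) (A' : M.Types Δ)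
    (hA : A' = tySub A σ) (h : A = tySub (K.fst x.1) x.2)
    (h' : A' = tySub (K.fst x.1) (σ ≫ x.2)) (f : M.Terms Γ) (hf : tp f = tySub (S.pi x.1) x.2)
    (hf' : tp (tmSub f σ) = tySub (S.pi x.1) (σ ≫ x.2)) :
    M.lift σ A A' hA ≫ S.uncurry x A h f hf =
      S.uncurry ⟨x.1, σ ≫ x.2⟩ A' h' (tmSub f σ) hf' := by
  rw [uncurry, uncurry, ← Category.assoc]
  congr 1
  exact M.lift_comp (M.comp_pair _ _ _ _ _ _) _ _ _ _ _ _

theorem uncurry_lam (x : Σ k, (Γ ⟶ K.obj k)) (A : M.Types Γ) (h : A = tySub (K.fst x.1) x.2)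
    (b : M.Terms (M.ext A)) (hb : tp b = tySub (K.snd x.1) (M.lift x.2 (K.fst x.1) A h))
    (hf : tp (S.lam x A h b hb) = tySub (S.pi x.1) x.2) :
    S.uncurry x A h (S.lam x A h b hb) hf = M.pair (K.snd x.1) _ b hb := by
  have e := S.pair_lam x A h b hb hf
  have e' := S.lift_curry_ev x A h (M.pair (K.snd x.1) _ b hb) (M.pair_wk _ _ _ _)
    (e ▸ S.fst_eq_sub_pair x h _ hf)
  rw [uncurry, ← e']
  congr 2

theorem lam_uncurry (x : Σ k, (Γ ⟶ K.obj k)) (A : M.Types Γ) (h : A = tySub (K.fst x.1) x.2)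
    (f : M.Terms Γ) (hf : tp f = tySub (S.pi x.1) x.2) (b : M.Terms (M.ext A))
    (hb : tp b = tySub (K.snd x.1) (M.lift x.2 (K.fst x.1) A h))
    (e : b = tmSub (M.var (K.snd x.1)) (S.uncurry x A h f hf)) :
    S.lam x A h b hb = f := by
  rw [lam, ← S.eq_curry x A h (M.pair (K.snd x.1) _ b hb) (M.pair_wk _ _ _ _)
    (M.pair (S.pi x.1) x.2 f hf) (M.pair_wk _ _ _ _), M.var_pair]
  intro h'
  apply M.hom_ext
  · rw [M.pair_wk]
    exact S.uncurry_wk x A h f hf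
  · rw [M.var_pair, e, uncurry]

/-- Application for an instance of a generic pair of types. -/
def app (x : Σ k, (Γ ⟶ K.obj k)) (A : M.Types Γ) (h : A = tySub (K.fst x.1) x.2)
    (f a : M.Terms Γ) (hf : tp f = tySub (S.pi x.1) x.2) (ha : tp a = A) : M.Terms Γ :=
  tmSub (M.var (K.snd x.1)) (M.inst A a ha ≫ S.uncurry x A h f hf)

theorem app_sub (σ : Δ ⟶ Γ) (x : Σ k, (Γ ⟶ K.obj k)) (y : Σ k, (Δ ⟶ K.obj k))
    (e : y = ⟨x.1, σ ≫ x.2⟩) (A : M.Types Γ) (h : A = tySub (K.fst x.1) x.2)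
    (h' : tySub A σ = tySub (K.fst y.1) y.2) (f a : M.Terms Γ)
    (hf : tp f = tySub (S.pi x.1) x.2) (hf' : tp (tmSub f σ) = tySub (S.pi y.1) y.2)
    (ha : tp a = A) (ha' : tp (tmSub a σ) = tySub A σ) :
    tmSub (S.app x A h f a hf ha) σ = S.app y (tySub A σ) h' (tmSub f σ) (tmSub a σ) hf' ha' := by
  subst e
  rw [app, app, ← tmSub_comp, ← S.lift_uncurry σ x A _ rfl h h' f hf hf', ← Category.assoc,
    ← Category.assoc, M.inst_lift σ A a ha ha']

/-- Instantiating the weakened type at its own variable is the identity substitution of Γ.A; this is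
what the η-rule needs. -/
theorem app_var (x : Σ k, (Γ ⟶ K.obj k)) (A : M.Types Γ) (y : Σ k, (M.ext A ⟶ K.obj k))
    (e : y = ⟨x.1, M.wk A ≫ x.2⟩) (h : A = tySub (K.fst x.1) x.2)
    (h' : tySub A (M.wk A) = tySub (K.fst y.1) y.2) (f : M.Terms Γ)
    (hf : tp f = tySub (S.pi x.1) x.2) (hf' : tp (tmSub f (M.wk A)) = tySub (S.pi y.1) y.2) :
    S.app y (tySub A (M.wk A)) h' (tmSub f (M.wk A)) (M.var A) hf' (M.tp_var A) =
      tmSub (M.var (K.snd x.1)) (S.uncurry x A h f hf) := by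
  subst e
  rw [app, ← S.lift_uncurry (M.wk A) x A _ rfl h h' f hf hf', ← Category.assoc,
    M.inst_comp_lift]
  congr 1
  conv_rhs => rw [← Category.id_comp (S.uncurry x A h f hf)]
  congr 1
  apply M.hom_ext
  · rw [M.pair_wk, Category.id_comp]
  · rw [M.var_pair, tmSub_id]

/-- Dependent products from dependent products of the generic pairs. -/
noncomputable def piTypes : M.PiTypes where
  Pi A B := tySub (S.pi (K.map A B).1) (K.map A B).2
  Pi_sub σ A B := by rw [K.map_sub, tySub_comp]
  lam A b := S.lam (K.map A (tp b)) A (K.map_fst _ _) b (K.map_snd _ _)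
  tp_lam A b := S.tp_lam _ _ _ _ _
  app A B f a hf ha := S.app (K.map A B) A (K.map_fst _ _) f a hf ha
  tp_app A B f a hf ha := by
    rw [app, tp_tmSub, M.tp_var, ← tySub_comp, Category.assoc, uncurry_wk, M.inst_comp_lift,
      K.tySub_inst]
  beta A b a ha := by rw [app, uncurry_lam, tmSub_comp, M.var_pair]
  eta A B f hf := by
    -- Abstraction classifies the pair (A, tp b), whereas `f` belongs to (A, B). Generalizing over
    -- `b` allows tp b = B to be eliminated by substitution.
    have h : ∀ (b : M.Terms (M.ext A)), tp b = B →
        b = tmSub (M.var (K.snd (K.map A B).1))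
          (S.uncurry (K.map A B) A (K.map_fst A B) f hf) →
        S.lam (K.map A (tp b)) A (K.map_fst _ _) b (K.map_snd _ _) = f := by
      rintro b rfl e
      exact S.lam_uncurry _ _ _ _ _ _ _ e
    have e := S.app_var (K.map A B) A _ (K.map_sub (M.wk A) A B) (K.map_fst A B)
      (K.map_fst _ _) f hf ((M.tp_sub_eq hf _).trans (by rw [K.map_sub, tySub_comp]))
    refine h _ ?_ e
    rw [e, tp_tmSub, M.tp_var, ← tySub_comp, uncurry_wk]
    exact (K.map_snd A B).symm
  lam_sub σ A b := S.lam_sub σ _ _ (by rw [tp_tmSub, K.map_sub]) A _ rfl _ _ b _ _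
  app_sub σ A B f a hf ha := S.app_sub σ _ _ (K.map_sub σ A B) A _ _ f a hf _ ha _

end Products

end PairClassifier

end CwF

/-! ### Generic types, and formation and introduction of identity types -/

namespace CwF

variable {C : Type u} [Category.{v} C] {M : CwF.{w} C} {Γ Δ Θ : C}

variable (M) in
/-- A family of generic types, from which every type arises by substitution in a unique way: the
presheaf of types is a coproduct of representables. -/
structure TypeClassifier where
  Idx : Type x
  obj : Idx → C
  gen : ∀ k, M.Types (obj k)
  existsUnique : ∀ {Γ : C} (A : M.Types Γ), ∃! x : Σ k, (Γ ⟶ obj k), A = tySub (gen x.1) x.2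

namespace TypeClassifier

variable (K : M.TypeClassifier)

/-- The name of a type. -/
noncomputable def map (A : M.Types Γ) : Σ k, (Γ ⟶ K.obj k) := (K.existsUnique A).choose

theorem map_gen (A : M.Types Γ) : A = tySub (K.gen (K.map A).1) (K.map A).2 :=
  (K.existsUnique A).choose_spec.1

theorem eq_of_gen {A : M.Types Γ} {x y : Σ k, (Γ ⟶ K.obj k)} (hx : A = tySub (K.gen x.1) x.2)
    (hy : A = tySub (K.gen y.1) y.2) : x = y :=
  (K.existsUnique A).unique hx hy

/-- Both sides name A[σ], and names are unique. All strictness of the identity types rests on this.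
-/
theorem map_sub (σ : Δ ⟶ Γ) (A : M.Types Γ) :
    K.map (tySub A σ) = ⟨(K.map A).1, σ ≫ (K.map A).2⟩ :=
  K.eq_of_gen (K.map_gen _) ((congrArg (tySub · σ) (K.map_gen A)).trans (tySub_comp _ _ _).symm)

/-- Types in the contexts `Γ.A.A`, for the generic types `A`, with maps from `Γ.A` to their
extensions over the diagonal. -/
structure PathObjects where
  path : ∀ k, M.Types (M.ext (tySub (K.gen k) (M.wk (K.gen k))))
  diag : ∀ k, M.ext (K.gen k) ⟶ M.ext (path k)
  diag_wk : ∀ k, diag k ≫ M.wk (path k) = M.inst _ (M.var (K.gen k)) (M.tp_var _)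

namespace PathObjects

variable {K} (P : K.PathObjects)

/-- The substitution `(σ, a, b) : Δ ⟶ Γ.A.A`. -/
def pair₂ (A : M.Types Γ) (σ : Δ ⟶ Γ) (a b : M.Terms Δ) (ha : tp a = tySub A σ)
    (hb : tp b = tySub A σ) : Δ ⟶ M.ext (tySub A (M.wk A)) :=
  M.pair _ (M.pair A σ a ha) b (by rw [← tySub_comp, M.pair_wk, hb])

theorem comp_pair₂ (τ : Θ ⟶ Δ) (A : M.Types Γ) (σ : Δ ⟶ Γ) (a b : M.Terms Δ)
    (ha : tp a = tySub A σ) (hb : tp b = tySub A σ) (ha' : tp (tmSub a τ) = tySub A (τ ≫ σ))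
    (hb' : tp (tmSub b τ) = tySub A (τ ≫ σ)) :
    τ ≫ pair₂ A σ a b ha hb = pair₂ A (τ ≫ σ) (tmSub a τ) (tmSub b τ) ha' hb' := by
  apply M.hom_ext
  · rw [Category.assoc, pair₂, pair₂, M.pair_wk, M.pair_wk, M.comp_pair]
  · rw [tmSub_comp, pair₂, pair₂, M.var_pair, M.var_pair]

/-- Identity types for instances of a generic type. -/
def idAt (x : Σ k, (Γ ⟶ K.obj k)) (a b : M.Terms Γ) (ha : tp a = tySub (K.gen x.1) x.2)
    (hb : tp b = tySub (K.gen x.1) x.2) : M.Types Γ :=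
  tySub (P.path x.1) (pair₂ (K.gen x.1) x.2 a b ha hb)

/-- Reflexivity for instances of a generic type. -/
def reflAt (x : Σ k, (Γ ⟶ K.obj k)) (a : M.Terms Γ) (ha : tp a = tySub (K.gen x.1) x.2) :
    M.Terms Γ :=
  tmSub (M.var (P.path x.1)) (M.pair (K.gen x.1) x.2 a ha ≫ P.diag x.1)

theorem idAt_sub (σ : Δ ⟶ Γ) (x : Σ k, (Γ ⟶ K.obj k)) (y : Σ k, (Δ ⟶ K.obj k))
    (e : y = ⟨x.1, σ ≫ x.2⟩) (a b : M.Terms Γ) (ha : tp a = tySub (K.gen x.1) x.2)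
    (hb : tp b = tySub (K.gen x.1) x.2) (ha' : tp (tmSub a σ) = tySub (K.gen y.1) y.2)
    (hb' : tp (tmSub b σ) = tySub (K.gen y.1) y.2) :
    tySub (P.idAt x a b ha hb) σ = P.idAt y (tmSub a σ) (tmSub b σ) ha' hb' := by
  subst e
  rw [idAt, idAt, ← tySub_comp]
  congr 1
  exact comp_pair₂ _ _ _ _ _ _ _ _ _

theorem reflAt_sub (σ : Δ ⟶ Γ) (x : Σ k, (Γ ⟶ K.obj k)) (y : Σ k, (Δ ⟶ K.obj k))
    (e : y = ⟨x.1, σ ≫ x.2⟩) (a : M.Terms Γ) (ha : tp a = tySub (K.gen x.1) x.2)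
    (ha' : tp (tmSub a σ) = tySub (K.gen y.1) y.2) :
    tmSub (P.reflAt x a ha) σ = P.reflAt y (tmSub a σ) ha' := by
  subst e
  rw [reflAt, reflAt, ← tmSub_comp, ← Category.assoc]
  congr 2
  exact M.comp_pair _ _ _ _ _ _

theorem pair_comp_inst_var (A : M.Types Γ) (σ : Δ ⟶ Γ) (a : M.Terms Δ) (ha : tp a = tySub A σ) :
    M.pair A σ a ha ≫ M.inst _ (M.var A) (M.tp_var A) = pair₂ A σ a a ha ha := by
  apply M.hom_ext
  · rw [Category.assoc, M.inst_wk, Category.comp_id, pair₂, M.pair_wk]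
  · rw [tmSub_comp, M.var_inst, M.var_pair, pair₂, M.var_pair]

theorem tp_reflAt (x : Σ k, (Γ ⟶ K.obj k)) (a : M.Terms Γ) (ha : tp a = tySub (K.gen x.1) x.2) :
    tp (P.reflAt x a ha) = P.idAt x a a ha ha := by
  rw [reflAt, tp_tmSub, M.tp_var, ← tySub_comp, Category.assoc, P.diag_wk, pair_comp_inst_var,
    idAt]

/-- Formation and introduction of identity types from path objects of the generic types. -/
noncomputable def idIntro : M.IdIntro where
  Id a b h := P.idAt (K.map (tp a)) a b (K.map_gen _) (h ▸ K.map_gen (tp a))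
  Id_sub σ a b h := P.idAt_sub σ _ _ (by rw [tp_tmSub, K.map_sub]) _ _ _ _ _ _
  refl a := P.reflAt (K.map (tp a)) a (K.map_gen _)
  tp_refl a := P.tp_reflAt _ _ _
  refl_sub σ a := P.reflAt_sub σ _ _ (by rw [tp_tmSub, K.map_sub]) _ _ _

/-- By uniqueness of names, any presentation of the type as an instance of a generic one may be used
in place of the chosen one. -/
theorem Id_eq_idAt (x : Σ k, (Γ ⟶ K.obj k)) (a b : M.Terms Γ) (h : tp a = tp b)
    (ha : tp a = tySub (K.gen x.1) x.2) (hb : tp b = tySub (K.gen x.1) x.2) :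
    P.idIntro.Id a b h = P.idAt x a b ha hb := by
  obtain rfl := K.eq_of_gen ha (K.map_gen _)
  rfl

theorem refl_eq_reflAt (x : Σ k, (Γ ⟶ K.obj k)) (a : M.Terms Γ)
    (ha : tp a = tySub (K.gen x.1) x.2) : P.idIntro.refl a = P.reflAt x a ha := by
  obtain rfl := K.eq_of_gen ha (K.map_gen _)
  rfl

/-- The two variables of Γ.A.A form the identity substitution. It is kept in the statement so that
`lift (𝟙 _)` compares the two context extensions. -/
theorem gen_gen (k : K.Idx) : P.idIntro.gen (K.gen k) = tySub (P.path k) (𝟙 _) := by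
  have ha : tp (tmSub (M.var (K.gen k)) (M.wk (tySub (K.gen k) (M.wk (K.gen k))))) =
      tySub (K.gen k) (M.wk (tySub (K.gen k) (M.wk (K.gen k))) ≫ M.wk (K.gen k)) := by
    rw [tp_tmSub, M.tp_var, tySub_comp]
  have hb : tp (M.var (tySub (K.gen k) (M.wk (K.gen k)))) =
      tySub (K.gen k) (M.wk (tySub (K.gen k) (M.wk (K.gen k))) ≫ M.wk (K.gen k)) := by
    rw [M.tp_var, tySub_comp]
  refine (P.Id_eq_idAt ⟨k, M.wk (tySub (K.gen k) (M.wk (K.gen k))) ≫ M.wk (K.gen k)⟩ _ _ _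
    ha hb).trans ?_
  rw [idAt]
  congr 1
  apply M.hom_ext
  · rw [pair₂, M.pair_wk, Category.id_comp]
    apply M.hom_ext
    · rw [M.pair_wk]
    · rw [M.var_pair]
  · rw [pair₂, M.var_pair, tmSub_id]

/-- The comparison map is an isomorphism, so ρ of a generic type inherits the lifting property of
`diag`. -/
theorem rho_gen_comp (k : K.Idx) :
    P.idIntro.rho (K.gen k) ≫ M.lift (𝟙 _) (P.path k) _ (P.gen_gen k) = P.diag k := by
  apply M.hom_ext
  · rw [Category.assoc, M.lift_wk, Category.comp_id, IdIntro.rho, M.pair_wk, P.diag_wk]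
  · rw [tmSub_comp, M.var_lift, IdIntro.rho, M.var_pair,
      P.refl_eq_reflAt ⟨k, M.wk (K.gen k)⟩ (M.var (K.gen k)) (M.tp_var _), reflAt]
    have : M.pair (K.gen k) (M.wk (K.gen k)) (M.var (K.gen k)) (M.tp_var _) = 𝟙 _ := by
      apply M.hom_ext
      · rw [M.pair_wk, Category.id_comp]
      · rw [M.var_pair, tmSub_id]
    rw [this, Category.id_comp]

instance isIso_lift_id (A A' : M.Types Γ) (h : A' = tySub A (𝟙 Γ)) :
    IsIso (M.lift (𝟙 Γ) A A' h) :=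
  (M.isPullback_lift (𝟙 Γ) A A' h).isIso_snd_of_isIso

end PathObjects

end TypeClassifier

/-! ### Elimination for identity types from generic problems -/

namespace IdIntro

variable (I : M.IdIntro)

/-- A family of generic elimination problems for identity types, from which every such problem
arises by substitution in a unique way, and solutions of the generic problems. -/
structure Eliminator where
  Idx : Type x
  obj : Idx → C
  ty : ∀ k, M.Types (obj k)
  motive : ∀ k, M.Types (I.ctx (ty k))
  base : ∀ k, M.Terms (M.ext (ty k))
  existsUnique : ∀ {Γ : C} (A : M.Types Γ) (T : M.Types (I.ctx A)) (t : M.Terms (M.ext A)),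
    tp t = tySub T (I.rho A) → ∃! x : Σ k, (Γ ⟶ obj k), ∃ h : A = tySub (ty x.1) x.2,
      T = tySub (motive x.1) (I.liftCtx x.2 _ A h) ∧ t = tmSub (base x.1) (M.lift x.2 _ A h)
  elim : ∀ k, M.Terms (I.ctx (ty k))
  tp_elim : ∀ k, tp (elim k) = motive k
  elim_rho : ∀ k, tmSub (elim k) (I.rho (ty k)) = base k

namespace Eliminator

variable {I} (E : I.Eliminator)

/-- The substitution that yields an elimination problem from a generic one. -/
noncomputable def map (A : M.Types Γ) (T : M.Types (I.ctx A)) (t : M.Terms (M.ext A))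
    (ht : tp t = tySub T (I.rho A)) : Σ k, (Γ ⟶ E.obj k) := (E.existsUnique A T t ht).choose

theorem map_spec (A : M.Types Γ) (T : M.Types (I.ctx A)) (t : M.Terms (M.ext A))
    (ht : tp t = tySub T (I.rho A)) :
    ∃ h : A = tySub (E.ty (E.map A T t ht).1) (E.map A T t ht).2,
      T = tySub (E.motive _) (I.liftCtx (E.map A T t ht).2 _ A h) ∧
        t = tmSub (E.base _) (M.lift (E.map A T t ht).2 _ A h) :=
  (E.existsUnique A T t ht).choose_spec.1

theorem map_ty (A : M.Types Γ) (T : M.Types (I.ctx A)) (t : M.Terms (M.ext A))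
    (ht : tp t = tySub T (I.rho A)) : A = tySub (E.ty (E.map A T t ht).1) (E.map A T t ht).2 :=
  (E.map_spec A T t ht).1

/-- The composite with `σ` also classifies the substituted problem, and classifying maps are unique.
-/
theorem map_sub (σ : Δ ⟶ Γ) (A : M.Types Γ) (T : M.Types (I.ctx A)) (t : M.Terms (M.ext A))
    (ht : tp t = tySub T (I.rho A))
    (ht' : tp (tmSub t (M.lift σ A _ rfl)) = tySub (tySub T (I.lift₃ σ A)) (I.rho _)) :
    E.map (tySub A σ) (tySub T (I.lift₃ σ A)) (tmSub t (M.lift σ A _ rfl)) ht' =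
      ⟨(E.map A T t ht).1, σ ≫ (E.map A T t ht).2⟩ := by
  obtain ⟨h, hT, ht₁⟩ := E.map_spec A T t ht
  have h' : tySub A σ = tySub (E.ty (E.map A T t ht).1) (σ ≫ (E.map A T t ht).2) :=
    (congrArg (tySub · σ) h).trans (tySub_comp _ _ _).symm
  refine (E.existsUnique _ _ _ ht').unique (E.map_spec _ _ _ ht') ⟨h', ?_, ?_⟩
  · refine (congrArg (tySub · (I.lift₃ σ A)) hT).trans ?_
    change tySub (tySub _ _) (I.liftCtx σ A (tySub A σ) rfl) = _
    rw [← tySub_comp]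
    exact congrArg _ (I.liftCtx_comp rfl _ _ _ _ _ _)
  · refine (congrArg (tmSub · (M.lift σ A _ rfl)) ht₁).trans ?_
    rw [← tmSub_comp]
    exact congrArg _ (M.lift_comp rfl _ _ _ _ _ _)

theorem elim_liftCtx_congr {x y : Σ k, (Γ ⟶ E.obj k)} (e : x = y) (A : M.Types Γ)
    (h : A = tySub (E.ty x.1) x.2) (h' : A = tySub (E.ty y.1) y.2) :
    tmSub (E.elim x.1) (I.liftCtx x.2 _ A h) = tmSub (E.elim y.1) (I.liftCtx y.2 _ A h') := by
  subst e; rfl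

/-- Identity types from solutions of the generic elimination problems. -/
noncomputable def idTypes : M.IdTypes where
  toIdIntro := I
  j A T t ht := tmSub (E.elim _) (I.liftCtx (E.map A T t ht).2 _ A (E.map_ty A T t ht))
  tp_j A T t ht := by
    rw [tp_tmSub, E.tp_elim]
    exact (E.map_spec A T t ht).2.1.symm
  j_rho A T t ht := by
    rw [← tmSub_comp, I.rho_liftCtx, tmSub_comp, E.elim_rho]
    exact (E.map_spec A T t ht).2.2.symm
  j_sub σ A T t ht := by
    have h' : tySub A σ = tySub (E.ty (E.map A T t ht).1) (σ ≫ (E.map A T t ht).2) :=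
      (congrArg (tySub · σ) (E.map_ty A T t ht)).trans (tySub_comp _ _ _).symm
    refine Eq.trans ?_ (E.elim_liftCtx_congr (E.map_sub σ A T t ht _).symm _ h' _)
    rw [← tmSub_comp]
    exact congrArg _ (I.liftCtx_comp rfl _ _ _ _ _ _)

end Eliminator

end IdIntro

end CwF

/-! ### Dependent products, partial products and anodyne maps in a closed class -/

namespace IsDependentProduct

variable {C : Type u} [Category.{v} C]

/-- The map `k` is determined by its two components, so "some `k`" may be replaced by "every `k`"; a
particular substitution can then be inserted for `k`. -/
theorem existsUnique_forall {B E F P PE : C} {d : E ⟶ B} {q : F ⟶ E} {r : P ⟶ B} {p₁ : PE ⟶ P}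
    {p₂ : PE ⟶ E} {ev : PE ⟶ F} (H : IsDependentProduct d q r p₁ p₂ ev) {T TE : C} (z : T ⟶ B)
    (t₁ : TE ⟶ T) (t₂ : TE ⟶ E) (ht : IsPullback t₁ t₂ z d) (g : TE ⟶ F) (hg : g ≫ q = t₂) :
    ∃! h : T ⟶ P, h ≫ r = z ∧ ∀ k : TE ⟶ PE, k ≫ p₁ = t₁ ≫ h → k ≫ p₂ = t₂ → k ≫ ev = g := by
  obtain ⟨h, ⟨hr, k, hk₁, hk₂, hk⟩, hu⟩ := H.existsUnique z t₁ t₂ ht g hg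
  refine ⟨h, ⟨hr, fun k' h₁ h₂ => ?_⟩, fun h' ⟨hr', hk'⟩ => hu h' ⟨hr', ?_⟩⟩
  · rw [← hk, H.isPullback.hom_ext (h₁.trans hk₁.symm) (h₂.trans hk₂.symm)]
  · have w : (t₁ ≫ h') ≫ r = t₂ ≫ d := by rw [Category.assoc, hr', ht.w]
    exact ⟨H.isPullback.lift _ _ w, H.isPullback.lift_fst _ _ w, H.isPullback.lift_snd _ _ w,
      hk' _ (H.isPullback.lift_fst _ _ w) (H.isPullback.lift_snd _ _ w)⟩

theorem of_iso {B E F P PE P' PE' : C} {d : E ⟶ B} {q : F ⟶ E} {r : P ⟶ B} {p₁ : PE ⟶ P}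
    {p₂ : PE ⟶ E} {ev : PE ⟶ F} (H : IsDependentProduct d q r p₁ p₂ ev) {r' : P' ⟶ B}
    {p₁' : PE' ⟶ P'} {p₂' : PE' ⟶ E} (H' : IsPullback p₁' p₂' r' d) (e : P' ≅ P)
    (he : e.hom ≫ r = r') : ∃ ev' : PE' ⟶ F, IsDependentProduct d q r' p₁' p₂' ev' := by
  have w : (p₁' ≫ e.hom) ≫ r = p₂' ≫ d := by rw [Category.assoc, he, H'.w]
  have w₁ := H.isPullback.lift_fst _ _ w
  have w₂ := H.isPullback.lift_snd _ _ w
  set l := H.isPullback.lift _ _ w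
  refine ⟨l ≫ ev, H', by rw [Category.assoc, H.ev_comp, w₂], fun {T TE} z t₁ t₂ ht g hg => ?_⟩
  obtain ⟨h, ⟨hr, hk⟩, hu⟩ := H.existsUnique_forall z t₁ t₂ ht g hg
  refine ⟨h ≫ e.inv, ⟨?_, ?_⟩, ?_⟩
  · rw [Category.assoc, ← he, Iso.inv_hom_id_assoc, hr]
  · have w' : (t₁ ≫ h ≫ e.inv) ≫ r' = t₂ ≫ d := by
      rw [Category.assoc, Category.assoc, ← he, Iso.inv_hom_id_assoc, hr, ht.w]
    refine ⟨H'.lift _ _ w', H'.lift_fst _ _ w', H'.lift_snd _ _ w', ?_⟩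
    rw [← Category.assoc]
    apply hk
    · rw [Category.assoc, w₁, ← Category.assoc, H'.lift_fst, Category.assoc, Category.assoc,
        Iso.inv_hom_id, Category.comp_id]
    · rw [Category.assoc, w₂, H'.lift_snd]
  · rintro h' ⟨hr', k, hk₁, hk₂, hk'⟩
    rw [Iso.eq_comp_inv]
    refine hu _ ⟨by rw [Category.assoc, he, hr'], fun k' h₁ h₂ => ?_⟩
    rw [← hk', ← Category.assoc]
    congr 1
    apply H.isPullback.hom_ext
    · rw [h₁, Category.assoc, w₁, ← Category.assoc, ← hk₁, Category.assoc]
    · rw [h₂, Category.assoc, w₂, hk₂]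

end IsDependentProduct

namespace IsClosedClass

variable {C : Type u} [Category.{v} C] {D : MorphismProperty C} [D.HasPullbacks]
  [D.IsStableUnderBaseChange]

/-- The freedom in `e` and in the pullback square allows P to be replaced by an isomorphic context
extension and the chosen pullback by a square of context extensions. -/
theorem exists_isDependentProduct (hc : IsClosedClass D) {B E F : C} (d : E ⟶ B) (q : F ⟶ E)
    (hd : D d) (hq : D q) : ∃ (P : C) (r : P ⟶ B), D r ∧
      ∀ {P' PE : C} (e : P' ≅ P) (p₁ : PE ⟶ P') (p₂ : PE ⟶ E), IsPullback p₁ p₂ (e.hom ≫ r) d →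
        ∃ ev : PE ⟶ F, IsDependentProduct d q (e.hom ≫ r) p₁ p₂ ev := by
  obtain ⟨R, adj, h⟩ := hc.pushforward d hd
  refine ⟨_, (R.obj (MorphismProperty.Over.mk ⊤ q hq)).hom,
    (R.obj (MorphismProperty.Over.mk ⊤ q hq)).prop, fun e p₁ p₂ hp => ?_⟩
  exact (h (MorphismProperty.Over.mk ⊤ q hq)).of_iso hp e rfl

/-- Maps `T ×_B E ⟶ X` are classified by a `D`-map over `B`. -/
theorem exists_partialProduct (hc : IsClosedClass D) {B E : C} (d : E ⟶ B) (hd : D d) (X : C) :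
    ∃ (P : C) (r : P ⟶ B), D r ∧ ∀ {PE : C} (p₁ : PE ⟶ P) (p₂ : PE ⟶ E), IsPullback p₁ p₂ r d →
      ∃ ev : PE ⟶ X, ∀ {T TE : C} (z : T ⟶ B) (t₁ : TE ⟶ T) (t₂ : TE ⟶ E),
        IsPullback t₁ t₂ z d → ∀ g : TE ⟶ X, ∃! h : T ⟶ P, h ≫ r = z ∧
          ∀ k : TE ⟶ PE, k ≫ p₁ = t₁ ≫ h → k ≫ p₂ = t₂ → k ≫ ev = g := by
  have := hc.hasTerminal
  have hX : D (Limits.terminal.from X) := hc.toTerminal _ ⟨Limits.terminalIsTerminal⟩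
  have : Limits.HasPullback (Limits.terminal.from X) (Limits.terminal.from E) :=
    MorphismProperty.HasPullbacks.hasPullback _ hX
  -- Maps to `X` are maps over E to X × E, so the partial product is the dependent product along `d`
  -- of the projection X × E ⟶ E. The projection is a pullback of X ⟶ 1, hence in `D`.
  obtain ⟨P, r, hr, h⟩ := hc.exists_isDependentProduct d
    (Limits.pullback.snd (Limits.terminal.from X) (Limits.terminal.from E)) hd
    (MorphismProperty.pullback_snd (P := D) _ _ hX)
  refine ⟨P, r, hr, fun p₁ p₂ hp => ?_⟩
  obtain ⟨ev, H⟩ := h (Iso.refl P) p₁ p₂ (by rwa [Iso.refl_hom, Category.id_comp])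
  rw [Iso.refl_hom, Category.id_comp] at H
  refine ⟨ev ≫ Limits.pullback.fst _ _, fun z t₁ t₂ ht g => ?_⟩
  have := H.existsUnique_forall z t₁ t₂ ht
    (Limits.pullback.lift g t₂ (Limits.terminal.hom_ext _ _)) (Limits.pullback.lift_snd _ _ _)
  refine (existsUnique_congr fun c => and_congr_right fun _ => forall_congr' fun k =>
    forall_congr' fun _ => forall_congr' fun h₂ => ?_).1 this
  constructor
  · intro e
    rw [← Category.assoc, e, Limits.pullback.lift_fst]
  · intro e
    apply Limits.pullback.hom_ext
    · rw [Limits.pullback.lift_fst, Category.assoc, e]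
    · rw [Limits.pullback.lift_snd, Category.assoc, H.ev_comp, h₂]

/-- Anodyne maps are stable under pullback along `D`-maps. -/
theorem llp_of_isPullback (hc : IsClosedClass D) {E I E' I' : C} {r : E ⟶ I} {r' : E' ⟶ I'}
    {e : E' ⟶ E} {i : I' ⟶ I} (h : IsPullback r' e i r) (hi : D i) (hr : D.llp r) :
    D.llp r' := by
  intro X Y p hp
  refine ⟨fun {f g} sq => ?_⟩
  have : Limits.HasPullback p g := MorphismProperty.HasPullbacks.hasPullback _ hp
  -- After pulling `p` back along `g`, the problem is to extend a map over I' from E' = E ×_I I' to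
  -- a section over I'. It is transposed along `i` to a lifting problem of `r` against the
  -- pushforward `s`, which is in `D`.
  obtain ⟨P, s, hs, H⟩ := hc.exists_isDependentProduct i (Limits.pullback.snd p g) hi
    (MorphismProperty.pullback_snd (P := D) _ _ hp)
  have : Limits.HasPullback s i := MorphismProperty.HasPullbacks.hasPullback _ hs
  obtain ⟨ev, H⟩ := H (Iso.refl P) (Limits.pullback.fst s i) (Limits.pullback.snd s i)
    (by rw [Iso.refl_hom, Category.id_comp]; exact IsPullback.of_hasPullback s i)
  rw [Iso.refl_hom, Category.id_comp] at H
  obtain ⟨c, ⟨hc₁, k, hk₁, hk₂, hk₃⟩, -⟩ := H.existsUnique r e r' h.flip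
    (Limits.pullback.lift f r' sq.w) (Limits.pullback.lift_snd _ _ _)
  have := hr s hs
  have sq' : CommSq c r s (𝟙 I) := ⟨by rw [hc₁, Category.comp_id]⟩
  have hl : sq'.lift ≫ s = 𝟙 I := sq'.fac_right
  -- The filler is a section of `s`; `m` is its pullback along `i`, and evaluation turns `m` into
  -- the required section over I'.
  let m : I' ⟶ Limits.pullback s i := Limits.pullback.lift (i ≫ sq'.lift) (𝟙 I')
    (by rw [Category.assoc, hl, Category.comp_id, Category.id_comp])
  have hm : r' ≫ m = k := by
    apply Limits.pullback.hom_ext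
    · rw [hk₁, Category.assoc, Limits.pullback.lift_fst, ← Category.assoc, h.w, Category.assoc,
        sq'.fac_left]
    · rw [hk₂, Category.assoc, Limits.pullback.lift_snd, Category.comp_id]
  refine ⟨⟨⟨m ≫ ev ≫ Limits.pullback.fst p g, ?_, ?_⟩⟩⟩
  · rw [← Category.assoc, hm, ← Category.assoc, hk₃, Limits.pullback.lift_fst]
  · rw [Category.assoc, Category.assoc, Limits.pullback.condition, ← Category.assoc ev, H.ev_comp,
      ← Category.assoc, Limits.pullback.lift_snd, Category.id_comp]

end IsClosedClass

/-! ### Construction of the generic data from a closed, factorizing class -/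

namespace CwF

variable {C : Type u} [Category.{v} C] {M : CwF.{w} C} {Γ Δ Θ : C}

namespace PairClassifier

/-- A classifier of pairs of types from a unique way to obtain pairs from the generic ones. -/
noncomputable def ofExistsUnique {Idx : Type*} (obj : Idx → C) (fst : ∀ k, M.Types (obj k))
    (snd : ∀ k, M.Types (M.ext (fst k)))
    (H : ∀ {Γ : C} (A : M.Types Γ) (B : M.Types (M.ext A)), ∃! x : Σ k, (Γ ⟶ obj k),
      ∃ h : A = tySub (fst x.1) x.2, B = tySub (snd x.1) (M.lift x.2 _ A h)) :
    M.PairClassifier where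
  Idx := Idx
  obj := obj
  fst := fst
  snd := snd
  map A B := (H A B).choose
  map_fst A B := (H A B).choose_spec.1.choose
  map_snd A B := (H A B).choose_spec.1.choose_spec
  map_sub σ A B := by
    obtain ⟨h, hB⟩ := (H A B).choose_spec.1
    have h' := (congrArg (tySub · σ) h).trans (tySub_comp _ _ _).symm
    refine (H _ _).unique (H _ _).choose_spec.1 ⟨h', ?_⟩
    refine (congrArg (tySub · (M.lift σ A _ rfl)) hB).trans ((tySub_comp _ _ _).symm.trans ?_)
    exact congrArg _ (M.lift_comp rfl _ _ _ _ _ _)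

end PairClassifier

variable {D : MorphismProperty C}

namespace TypeClassifier

/-- Factorizations of the diagonals of the generic types are path objects. -/
theorem exists_pathObjects (K : TypeClassifier.{w, v, u, x} M)
    (hfact : MorphismProperty.HasFactorization D.llp D)
    (hE : ∀ {Γ E : C} (d : E ⟶ Γ), D d →
      ∃ (A : M.Types Γ) (e : M.ext A ≅ E), e.hom ≫ d = M.wk A) :
    ∃ P : K.PathObjects, ∀ k, D.llp (P.idIntro.rho (K.gen k)) := by
  -- The `D`-part of the factorization is replaced by an isomorphic display map; the isomorphism is
  -- absorbed into the anodyne part.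
  have h : ∀ k : K.Idx, ∃ (A : M.Types (M.ext (tySub (K.gen k) (M.wk (K.gen k)))))
      (i : M.ext (K.gen k) ⟶ M.ext A), i ≫ M.wk A = M.inst _ (M.var (K.gen k)) (M.tp_var _) ∧
        D.llp i := fun k => by
    obtain ⟨F⟩ := hfact.nonempty_mapFactorizationData
      (M.inst _ (M.var (K.gen k)) (M.tp_var (K.gen k)))
    obtain ⟨A, e, he⟩ := hE F.p F.hp
    refine ⟨A, F.i ≫ e.inv, ?_, D.llp.comp_mem _ _ F.hi (D.llp_of_isIso e.inv)⟩
    rw [← he, Category.assoc, Iso.inv_hom_id_assoc, F.fac]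
  choose path diag hdiag hllp using h
  refine ⟨⟨path, diag, hdiag⟩, fun k => ?_⟩
  have e := PathObjects.rho_gen_comp (K := K) ⟨path, diag, hdiag⟩ k
  rw [← IsIso.eq_comp_inv] at e
  rw [e]
  exact D.llp.comp_mem _ _ (hllp k) (D.llp_of_isIso _)

end TypeClassifier

namespace PairClassifier

/-- The composite projection Γ.A.B ⟶ Γ is again in `D`, hence isomorphic to a display map. -/
theorem exists_sums (K : M.PairClassifier) (hc : D.IsStableUnderComposition)
    (hD : ∀ (Γ : C) (A : M.Types Γ), D (M.wk A))
    (hE : ∀ {Γ E : C} (d : E ⟶ Γ), D d →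
      ∃ (A : M.Types Γ) (e : M.ext A ≅ E), e.hom ≫ d = M.wk A) : Nonempty K.Sums := by
  choose S e he using fun k => hE (M.wk (K.snd k) ≫ M.wk (K.fst k))
    (D.comp_mem _ _ (hD _ _) (hD _ _))
  exact ⟨⟨S, e, he⟩⟩

end PairClassifier

/-- A solution is a section of the display map of `T` extending (ρ, t), that is, a diagonal filler
for ρ against that display map. -/
theorem IdIntro.exists_elim {I : M.IdIntro} {A : M.Types Γ} (T : M.Types (I.ctx A))
    (hT : D (M.wk T)) (hA : D.llp (I.rho A)) (t : M.Terms (M.ext A))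
    (ht : tp t = tySub T (I.rho A)) :
    ∃ s : M.Terms (I.ctx A), tp s = T ∧ tmSub s (I.rho A) = t := by
  have := hA _ hT
  have sq : CommSq (M.pair T (I.rho A) t ht) (I.rho A) (M.wk T) (𝟙 _) :=
    ⟨by rw [M.pair_wk, Category.comp_id]⟩
  refine ⟨tmSub (M.var T) sq.lift, ?_, ?_⟩
  · rw [tp_tmSub, M.tp_var, ← tySub_comp, sq.fac_right, tySub_id]
  · rw [← tmSub_comp, sq.fac_left, M.var_pair]

variable [D.HasPullbacks] [D.IsStableUnderBaseChange]
  (K : TypeClassifier.{w, v, u, x} M)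

namespace TypeClassifier

/-- When `f` names A, the context Γ.A is the pullback along `f` of the generic display map. A name
`g` for a type over Γ.A is thus a map out of that pullback, classified by a partial product. -/
theorem exists_generic_pair (hc : IsClosedClass D) (hD : ∀ (Γ : C) (A : M.Types Γ), D (M.wk A))
    (k l : K.Idx) : ∃ (P : C) (r : P ⟶ K.obj k) (ev : M.ext (tySub (K.gen k) r) ⟶ K.obj l),
      ∀ {Γ : C} (f : Γ ⟶ K.obj k) (A : M.Types Γ), A = tySub (K.gen k) f →
        ∀ g : M.ext A ⟶ K.obj l, ∃! c : Γ ⟶ P, c ≫ r = f ∧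
          ∀ h, M.lift c (tySub (K.gen k) r) A h ≫ ev = g := by
  obtain ⟨P, r, -, H⟩ := hc.exists_partialProduct (M.wk (K.gen k)) (hD _ _) (K.obj l)
  obtain ⟨ev, H⟩ := H _ _ (M.isPullback_lift r (K.gen k) _ rfl)
  refine ⟨P, r, ev, fun f A hA g => ?_⟩
  refine (existsUnique_congr fun c => and_congr_right fun hcr => ?_).1
    (H f _ _ (M.isPullback_lift f (K.gen k) A hA) g)
  -- Guarantees that the quantifier over proofs `h` in the conclusion is not vacuous.
  have e : A = tySub (tySub (K.gen k) r) c := by rw [← tySub_comp, hcr, hA]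
  constructor
  · intro h h'
    exact h _ (M.lift_wk _ _ _ _) (M.lift_comp hcr _ _ _ _ _ _)
  · intro h k' h₁ h₂
    rw [← h e]
    congr 1
    apply (M.isPullback_lift r (K.gen k) _ rfl).hom_ext
    · rw [h₁, M.lift_wk]
    · rw [h₂]
      exact (M.lift_comp hcr _ _ _ _ _ _).symm

theorem exists_pairClassifier (K : TypeClassifier.{w, v, u, x} M) (hc : IsClosedClass D)
    (hD : ∀ (Γ : C) (A : M.Types Γ), D (M.wk A)) : Nonempty (PairClassifier.{w, v, u, x} M) := by
  choose P r ev H using K.exists_generic_pair hc hD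
  refine ⟨PairClassifier.ofExistsUnique (fun i : K.Idx × K.Idx => P i.1 i.2)
    (fun i => tySub (K.gen i.1) (r i.1 i.2)) (fun i => tySub (K.gen i.2) (ev i.1 i.2)) ?_⟩
  intro Γ A B
  obtain ⟨⟨k, f⟩, hA, -⟩ := K.existsUnique A
  obtain ⟨⟨l, g⟩, hB, -⟩ := K.existsUnique B
  obtain ⟨c, ⟨hcr, hcg⟩, hu⟩ := H k l f A hA g
  have h : A = tySub (tySub (K.gen k) (r k l)) c := by rw [← tySub_comp, hcr]; exact hA
  refine ⟨⟨(k, l), c⟩, ⟨h, ?_⟩, ?_⟩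
  · rw [← tySub_comp, hcg]
    exact hB
  · rintro ⟨⟨k', l'⟩, c'⟩ ⟨h', hB'⟩
    dsimp only at h' hB'
    rw [← tySub_comp] at hB'
    -- Uniqueness of the names of A and of B identifies first the indices, then the data that
    -- determine `c'`.
    obtain ⟨rfl, e⟩ := Sigma.mk.inj (K.eq_of_gen (x := ⟨k, f⟩) (y := ⟨k', c' ≫ r k' l'⟩) hA
      (h'.trans (tySub_comp _ _ _).symm))
    obtain ⟨rfl, e'⟩ := Sigma.mk.inj (K.eq_of_gen (x := ⟨l, g⟩) (y := ⟨l', _⟩) hB hB')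
    rw [hu c' ⟨(eq_of_heq e).symm, fun _ => (eq_of_heq e').symm⟩]

variable (I : M.IdIntro)

/-- The generic types in the contexts `Γ.A.A.Id_A`, for the instances `A` of a generic type. -/
theorem exists_generic_motive (hc : IsClosedClass D) (hD : ∀ (Γ : C) (A : M.Types Γ), D (M.wk A))
    (k l : K.Idx) :
    ∃ (P : C) (r : P ⟶ K.obj k) (A₀ : M.Types P) (_ : A₀ = tySub (K.gen k) r)
      (ev : I.ctx A₀ ⟶ K.obj l), D r ∧
      ∀ {Γ : C} (f : Γ ⟶ K.obj k) (A : M.Types Γ), A = tySub (K.gen k) f →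
        ∀ g : I.ctx A ⟶ K.obj l, ∃! c : Γ ⟶ P, c ≫ r = f ∧
          ∀ h, I.liftCtx c A₀ A h ≫ ev = g := by
  have := hc.comp
  -- The projection from Γ.A.A.Id_A is a composite of three display maps, so it is in `D` and has
  -- partial products.
  obtain ⟨P, r, hr, H⟩ := hc.exists_partialProduct (I.wkCtx (K.gen k))
    (D.comp_mem _ _ (hD _ _) (D.comp_mem _ _ (hD _ _) (hD _ _))) (K.obj l)
  obtain ⟨ev, H⟩ := H _ _ (I.isPullback_liftCtx r (K.gen k) _ rfl)
  refine ⟨P, r, _, rfl, ev, hr, fun f A hA g => ?_⟩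
  refine (existsUnique_congr fun c => and_congr_right fun hcr => ?_).1
    (H f _ _ (I.isPullback_liftCtx f (K.gen k) A hA) g)
  have e : A = tySub (tySub (K.gen k) r) c := by rw [← tySub_comp, hcr, hA]
  constructor
  · intro h h'
    exact h _ (I.isPullback_liftCtx _ _ _ _).w.symm (I.liftCtx_comp hcr _ _ _ _ _ _)
  · intro h k' h₁ h₂
    rw [← h e]
    congr 1
    apply (I.isPullback_liftCtx r (K.gen k) _ rfl).hom_ext
    · rw [h₁, (I.isPullback_liftCtx _ _ _ _).w]
    · rw [h₂]
      exact (I.liftCtx_comp hcr _ _ _ _ _ _).symm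

/-- The generic elimination problems for identity types. -/
theorem exists_generic_elimination (hc : IsClosedClass D)
    (hD : ∀ (Γ : C) (A : M.Types Γ), D (M.wk A)) (k l : K.Idx) :
    ∃ (P : C) (r : P ⟶ K.obj k) (A₀ : M.Types P) (_ : A₀ = tySub (K.gen k) r)
      (v : I.ctx A₀ ⟶ K.obj l) (t₀ : M.Terms (M.ext A₀)), D r ∧
      tp t₀ = tySub (tySub (K.gen l) v) (I.rho A₀) ∧
      ∀ {Γ : C} (f : Γ ⟶ K.obj k) (A : M.Types Γ), A = tySub (K.gen k) f →
        ∀ (g : I.ctx A ⟶ K.obj l) (t : M.Terms (M.ext A)),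
          tp t = tySub (tySub (K.gen l) g) (I.rho A) → ∃! c : Γ ⟶ P, c ≫ r = f ∧
            ∀ h, I.liftCtx c A₀ A h ≫ v = g ∧ t = tmSub t₀ (M.lift c A₀ A h) := by
  have := hc.comp
  obtain ⟨P₁, r₁, A₁, hA₁, ev₁, hr₁, H₁⟩ := K.exists_generic_motive I hc hD k l
  obtain ⟨B₁, hB₁⟩ : ∃ B, B = tySub (tySub (K.gen l) ev₁) (I.rho A₁) := ⟨_, rfl⟩
  have hB : ∀ {Δ : C} (σ : Δ ⟶ P₁) (A : M.Types Δ) (h : A = tySub A₁ σ),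
      tySub B₁ (M.lift σ A₁ A h) = tySub (tySub (K.gen l) (I.liftCtx σ A₁ A h ≫ ev₁)) (I.rho A) :=
    fun σ A h => by
      rw [hB₁, ← tySub_comp, ← tySub_comp, ← tySub_comp, ← Category.assoc, I.rho_liftCtx,
        Category.assoc]
  -- Over the context `P₁` of generic motives, a term `t` of T[ρ] over Γ.A is a map to the extension
  -- by `B₁` over that by `A₁`; the dependent product classifies it.
  obtain ⟨P, r, hr, H⟩ := hc.exists_isDependentProduct (M.wk A₁) (M.wk B₁) (hD _ _) (hD _ _)
  obtain ⟨ev, H⟩ := H (Iso.refl P) (M.wk (tySub A₁ r)) (M.lift r A₁ _ rfl)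
    (by rw [Iso.refl_hom, Category.id_comp]; exact M.isPullback_lift r A₁ _ rfl)
  rw [Iso.refl_hom, Category.id_comp] at H
  -- The generic type arises by two successive substitutions and equals the one along `r ≫ r₁` only
  -- propositionally, whence the separate `A₀` in the statement.
  refine ⟨P, r ≫ r₁, tySub A₁ r, by rw [hA₁, tySub_comp], I.liftCtx r A₁ _ rfl ≫ ev₁,
    tmSub (M.var B₁) ev, D.comp_mem _ _ hr hr₁, ?_, ?_⟩
  · rw [tp_tmSub, M.tp_var, ← hB]
    exact (tySub_comp _ _ _).symm.trans (congrArg _ H.ev_comp)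
  · intro Γ f A hA g t ht
    obtain ⟨c₁, ⟨hc₁, hg⟩, hu₁⟩ := H₁ f A hA g
    have e₁ : A = tySub A₁ c₁ := by rw [hA₁, ← tySub_comp, hc₁, hA]
    have ht' : tp t = tySub B₁ (M.lift c₁ A₁ A e₁) := by rw [ht, hB, hg e₁]
    obtain ⟨c, ⟨hcr, ht₁⟩, hu⟩ := H.existsUnique_forall c₁ _ _
      (M.isPullback_lift c₁ A₁ A e₁) (M.pair B₁ _ t ht') (M.pair_wk _ _ _ _)
    refine ⟨c, ⟨by rw [← Category.assoc, hcr, hc₁], fun h => ⟨?_, ?_⟩⟩, ?_⟩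
    · rw [← Category.assoc, I.liftCtx_comp hcr A₁ _ A rfl h e₁, hg]
    · rw [← tmSub_comp, ht₁ _ (M.lift_wk _ _ _ _) (M.lift_comp hcr _ _ _ _ _ _), M.var_pair]
    · rintro c' ⟨hc', h'⟩
      have e : A = tySub (tySub A₁ r) c' := by
        rw [hA₁, ← tySub_comp, ← tySub_comp, Category.assoc, hc', hA]
      have hcr' : c' ≫ r = c₁ := by
        refine hu₁ _ ⟨by rw [Category.assoc, hc'], fun h'' => ?_⟩
        rw [← I.liftCtx_comp rfl A₁ _ A rfl e h'', Category.assoc]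
        exact (h' e).1
      refine hu _ ⟨hcr', fun k' h₁ h₂ => ?_⟩
      have hk' : k' = M.lift c' _ A e := by
        apply (M.isPullback_lift r A₁ _ rfl).hom_ext
        · rw [h₁, M.lift_wk]
        · rw [h₂]
          exact (M.lift_comp hcr' _ _ _ _ _ _).symm
      apply M.hom_ext
      · rw [M.pair_wk, Category.assoc, H.ev_comp, h₂]
      · rw [M.var_pair, hk', tmSub_comp]
        exact (h' e).2.symm

/-- The base of a generic problem maps to that of a generic type by a `D`-map, so its ρ is the
pullback of an anodyne map along a `D`-map, hence anodyne. Anodyne ρ is not needed for other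
instances, whose eliminators are substituted from the generic ones. -/
theorem exists_eliminator (hc : IsClosedClass D) (hD : ∀ (Γ : C) (A : M.Types Γ), D (M.wk A))
    (hI : ∀ k, D.llp (I.rho (K.gen k))) : Nonempty (IdIntro.Eliminator.{w, v, u, x} I) := by
  choose P r A₀ hA₀ v t₀ hr ht₀ H using K.exists_generic_elimination I hc hD
  have hs : ∀ k l, ∃ s : M.Terms (I.ctx (A₀ k l)), tp s = tySub (K.gen l) (v k l) ∧
      tmSub s (I.rho (A₀ k l)) = t₀ k l := fun k l =>
    IdIntro.exists_elim _ (hD _ _) (hc.llp_of_isPullback (I.isPullback_rho (r k l) _ _ (hA₀ k l))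
      (D.of_isPullback (I.isPullback_liftCtx (r k l) _ _ (hA₀ k l)) (hr k l)) (hI k)) _ (ht₀ k l)
  choose s hs₁ hs₂ using hs
  refine ⟨⟨K.Idx × K.Idx, fun i => P i.1 i.2, fun i => A₀ i.1 i.2,
    fun i => tySub (K.gen i.2) (v i.1 i.2), fun i => t₀ i.1 i.2, ?_, fun i => s i.1 i.2,
    fun i => hs₁ i.1 i.2, fun i => hs₂ i.1 i.2⟩⟩
  intro Γ A T t ht
  obtain ⟨⟨k, f⟩, hA, -⟩ := K.existsUnique A
  obtain ⟨⟨l, g⟩, hT, -⟩ := K.existsUnique T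
  dsimp only at hA hT
  obtain ⟨c, ⟨hcr, hcg⟩, hu⟩ := H k l f A hA g t (by rw [ht, ← hT])
  have h : A = tySub (A₀ k l) c := by rw [hA₀, ← tySub_comp, hcr]; exact hA
  refine ⟨⟨(k, l), c⟩, ⟨h, ?_, (hcg h).2⟩, ?_⟩
  · rw [← tySub_comp, (hcg h).1]
    exact hT
  · rintro ⟨⟨k', l'⟩, c'⟩ ⟨h', hT', ht'⟩
    dsimp only at h' hT' ht'
    rw [← tySub_comp] at hT'
    obtain ⟨rfl, e⟩ := Sigma.mk.inj (K.eq_of_gen (x := ⟨k, f⟩) (y := ⟨k', c' ≫ r k' l'⟩) hA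
      (h'.trans (by rw [hA₀, ← tySub_comp])))
    obtain ⟨rfl, e'⟩ := Sigma.mk.inj (K.eq_of_gen (x := ⟨l, g⟩) (y := ⟨l', _⟩) hT hT')
    rw [hu c' ⟨(eq_of_heq e).symm, fun _ => ⟨(eq_of_heq e').symm, ht'⟩⟩]

end TypeClassifier
namespace PairClassifier

/-- The pushforward of one generic display map along the other is in `D`, hence isomorphic to a
display map, which inherits the universal property. -/
theorem exists_products (K : M.PairClassifier) (hc : IsClosedClass D)
    (hD : ∀ (Γ : C) (A : M.Types Γ), D (M.wk A))
    (hE : ∀ {Γ E : C} (d : E ⟶ Γ), D d →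
      ∃ (A : M.Types Γ) (e : M.ext A ≅ E), e.hom ≫ d = M.wk A) : Nonempty K.Products := by
  have h : ∀ k, ∃ (S : M.Types (K.obj k))
      (ev : M.ext (tySub (K.fst k) (M.wk S)) ⟶ M.ext (K.snd k)),
      IsDependentProduct (M.wk (K.fst k)) (M.wk (K.snd k)) (M.wk S) (M.wk _)
        (M.lift (M.wk S) (K.fst k) _ rfl) ev := fun k => by
    obtain ⟨P, r, hr, H⟩ := hc.exists_isDependentProduct (M.wk (K.fst k)) (M.wk (K.snd k))
      (hD _ _) (hD _ _)
    obtain ⟨S, e, he⟩ := hE r hr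
    obtain ⟨ev, H⟩ := H e (M.wk _) (M.lift (M.wk S) (K.fst k) _ rfl)
      (by rw [he]; exact M.isPullback_lift _ _ _ _)
    exact ⟨S, ev, by rwa [he] at H⟩
  choose S ev H using h
  refine ⟨⟨S, ev, fun k => (H k).ev_comp, fun x A h g hg => ?_⟩⟩
  refine (existsUnique_congr fun c => and_congr_right fun hcr => ?_).1
    ((H x.1).existsUnique_forall x.2 _ _ (M.isPullback_lift x.2 _ A h) g hg)
  have e : A = tySub (tySub (K.fst x.1) (M.wk (S x.1))) c := by rw [← tySub_comp, hcr, h]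
  constructor
  · intro h₀ h'
    exact h₀ _ (M.lift_wk _ _ _ _) (M.lift_comp hcr _ _ _ _ _ _)
  · intro h₀ k' h₁ h₂
    rw [← h₀ e]
    congr 1
    apply (M.isPullback_lift (M.wk (S x.1)) (K.fst x.1) _ rfl).hom_ext
    · rw [h₁, M.lift_wk]
    · rw [h₂]
      exact (M.lift_comp hcr _ _ _ _ _ _).symm

end PairClassifier

end CwF

/-! ### Local universes as generic types, and the conclusion -/

namespace LocalUniverse

variable {C : Type u} [Category.{v} C] (D : MorphismProperty C)

/-- The local universes classify the types of their category with families. -/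
def typeClassifier [D.HasPullbacks] [Limits.HasTerminal C] : (cwf D).TypeClassifier where
  Idx := LocalUniverse D
  obj := base
  gen U := ofName U (𝟙 U.base)
  existsUnique {Γ} A := by
    obtain ⟨U, f⟩ : Σ U : LocalUniverse D, (Γ ⟶ U.base) := A
    have h : ∀ (V : LocalUniverse D) (g : Γ ⟶ V.base),
        tySub (M := (cwf D).toTypesAndTerms) (ofName V (𝟙 V.base)) g = ofName V g := fun V g =>
      congrArg (ofName V) (Category.comp_id g)
    exact ⟨⟨U, f⟩, (h U f).symm, fun x hx => (hx.trans (h x.1 x.2)).symm⟩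

end LocalUniverse

theorem mainTheorem4 {C : Type u} [Category.{v} C] (D : MorphismProperty C)
    [D.HasPullbacks] [D.IsStableUnderBaseChange] (hclosed : IsClosedClass D)
    (hfact : MorphismProperty.HasFactorization D.llp D) :
    ∃ (M : CwF.{max u v} C) (hD : ∀ (Γ : C) (A : M.Types Γ), D (M.wk A)),
      Nonempty M.SigmaTypes ∧ Nonempty M.PiTypes ∧ Nonempty M.IdTypes ∧
      (∀ Γ : C, (M.display D hD Γ).IsEquivalence) ∧
      (∀ (Γ : C) (A : M.Types Γ), Function.Bijective (M.toSection A)) := by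
  have := hclosed.hasTerminal
  have hD : ∀ (Γ : C) (A : (LocalUniverse.cwf D).Types Γ), D ((LocalUniverse.cwf D).wk A) :=
    fun _ A => LocalUniverse.wk_mem A
  obtain ⟨K⟩ := (LocalUniverse.typeClassifier D).exists_pairClassifier hclosed hD
  obtain ⟨S⟩ := K.exists_sums hclosed.comp hD LocalUniverse.exists_ext_iso
  obtain ⟨P⟩ := K.exists_products hclosed hD LocalUniverse.exists_ext_iso
  obtain ⟨I, hI⟩ := (LocalUniverse.typeClassifier D).exists_pathObjects hfact
    LocalUniverse.exists_ext_iso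
  obtain ⟨E⟩ := (LocalUniverse.typeClassifier D).exists_eliminator I.idIntro hclosed hD hI
  exact ⟨LocalUniverse.cwf D, hD, ⟨S.sigmaTypes⟩, ⟨P.piTypes⟩, ⟨E.idTypes⟩,
    fun Γ => CwF.display_isEquivalence _ D hD Γ LocalUniverse.exists_ext_iso,
    fun Γ A => CwF.toSection_bijective _ A⟩
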